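/- Let $n \ge 2$ and let $\kappa : \mathbb{R} \to \mathbb{R}^n$ be a polynomial knot, i.e. a map whose components are polynomials, with $\kappa(s) \ne \kappa(t)$ for all $s \ne t$ and $\kappa'(t) \ne 0$ for all $t$. For $k \ge 1$ let $S^k \subset \mathbb{R}^{k+1}$ be the unit sphere and let $$\sigma_k : \mathbb{R}^k \cup \{\infty\} \to S^k, \qquad \sigma_k(x) = \left(\frac{2x}{|x|^2+1}, \frac{|x|^2-1}{|x|^2+1}\right), \quad \sigma_k(\infty) = (0,\dots,0,1),$$ be stereographic projection. Let the completion $\bar\kappa : S^1 \to S^n$ of $\kappa$ be the map with $\bar\kappa(\sigma_1(t)) = \sigma_n(\kappa(t))$ for $t \in \mathbb{R}$ that takes the north pole to the north pole. Then $\bar\kappa$ is a tame knot: $\bar\kappa$ is a continuous embedding, and there are a polygonal knot $\beta : S^1 \to S^n$ and orientation-preserving homeomorphisms $f$ of $S^1$ and $g$ of $S^n$ such that $\bar\kappa = g \circ \beta \circ f$. Here a polygonal knot is a continuous embedding $\beta : S^1 \to S^n$ whose image is $\sigma_n(P)$ for a closed polygon $P \subset \mathbb{R}^n$ (the union of the segments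 joining cyclically consecutive points of a finite sequence), and a homeomorphism of $S^k$ is orientation-preserving if it induces the identity on the singular homology group $H_k(S^k;\mathbb{Z})$. -/

import Mathlib

open CategoryTheory

noncomputable section

/-- Euclidean space `ℝⁿ`. -/
abbrev Euc (n : ℕ) : Type := EuclideanSpace ℝ (Fin n)

/-- The unit sphere `Sⁿ ⊂ ℝⁿ⁺¹`. -/
abbrev Sph (n : ℕ) : Type := Metric.sphere (0 : Euc (n + 1)) 1

/-- The north pole `(0, …, 0, 1)` of `Sⁿ`. -/
def northPole (n : ℕ) : Sph n :=
  ⟨EuclideanSpace.single (Fin.last n) 1, by simp⟩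

theorem stereoInv_mem {n : ℕ} (x : Euc n) :
    (WithLp.toLp 2 (Fin.snoc (α := fun _ => ℝ) (fun i => 2 * x i / (‖x‖ ^ 2 + 1))
      ((‖x‖ ^ 2 - 1) / (‖x‖ ^ 2 + 1))) : Euc (n + 1)) ∈ Metric.sphere (0 : Euc (n + 1)) 1 := by
  have h : ‖x‖ ^ 2 + 1 ≠ 0 := by positivity
  have hs : ∑ i : Fin n, (x i) ^ 2 = ‖x‖ ^ 2 := (EuclideanSpace.real_norm_sq_eq x).symm
  rw [mem_sphere_zero_iff_norm, ← sq_eq_sq₀ (norm_nonneg _) zero_le_one,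
    EuclideanSpace.real_norm_sq_eq, Fin.sum_univ_castSucc]
  simp only [Fin.snoc_castSucc, Fin.snoc_last, div_pow, mul_pow, ← Finset.sum_div,
    ← Finset.mul_sum, hs]
  field_simp
  ring

/-- Stereographic projection `ℝⁿ → Sⁿ`,
`x ↦ (2x / (|x|² + 1), (|x|² - 1) / (|x|² + 1))`; its image is `Sⁿ` without the north pole. -/
def stereoInv {n : ℕ} (x : Euc n) : Sph n :=
  ⟨WithLp.toLp 2 (Fin.snoc (α := fun _ => ℝ) (fun i => 2 * x i / (‖x‖ ^ 2 + 1))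
    ((‖x‖ ^ 2 - 1) / (‖x‖ ^ 2 + 1))), stereoInv_mem x⟩

/-- A polynomial knot: a smooth embedding `ℝ → ℝⁿ` whose components are polynomials, that is, a
polynomial map without double points and without critical points. -/
structure IsPolynomialKnot {n : ℕ} (κ : ℝ → Euc n) : Prop where
  polynomial : ∃ p : Fin n → Polynomial ℝ, ∀ t i, κ t i = (p i).eval t
  injective : Function.Injective κ
  deriv_ne_zero : ∀ t, deriv κ t ≠ 0

open Classical in
/-- The completion `κ̄ : S¹ → Sⁿ` of `κ : ℝ → ℝⁿ`. It takes the north pole to the north pole, and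
the point `(2t / (t² + 1), (t² - 1) / (t² + 1))` of `S¹`, whose coordinates `(x, y)` satisfy
`t = x / (1 - y)`, to `stereoInv (κ t)`. -/
def completion {n : ℕ} (κ : ℝ → Euc n) (p : Sph 1) : Sph n :=
  if p = northPole 1 then northPole n
  else stereoInv (κ ((p : Euc 2) 0 / (1 - (p : Euc 2) 1)))

/-- A topological knot: a continuous embedding of `S¹` in `Sⁿ`. -/
def IsTopologicalKnot {n : ℕ} (α : Sph 1 → Sph n) : Prop :=
  Topology.IsEmbedding α

/-- A homeomorphism of `Sᵏ` preserves the orientation if it has degree one, that is, if it induces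
the identity on the singular homology group `H_k(Sᵏ; ℤ)`. -/
def IsOrientationPreserving {k : ℕ} (e : Sph k ≃ₜ Sph k) : Prop :=
  ((AlgebraicTopology.singularHomologyFunctor (ModuleCat.{0} ℤ) k).obj (ModuleCat.of ℤ ℤ)).map
      (TopCat.ofHom (e : C(Sph k, Sph k))) =
    𝟙 (((AlgebraicTopology.singularHomologyFunctor (ModuleCat.{0} ℤ) k).obj
      (ModuleCat.of ℤ ℤ)).obj (TopCat.of (Sph k)))

/-- Topological equivalence of knots: `α₀ = g ∘ α₁ ∘ f` for orientation-preserving homeomorphisms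
`f` of `S¹` and `g` of `Sⁿ`. -/
def TopologicallyEquivalent {n : ℕ} (α₀ α₁ : Sph 1 → Sph n) : Prop :=
  ∃ (f : Sph 1 ≃ₜ Sph 1) (g : Sph n ≃ₜ Sph n),
    IsOrientationPreserving f ∧ IsOrientationPreserving g ∧ α₀ = g ∘ α₁ ∘ f

/-- A polygonal knot: a topological knot that traces a closed polygon in `ℝⁿ ⊂ Sⁿ`, where `ℝⁿ` is
identified with the complement of the north pole by stereographic projection. The polygon is the
union of the segments between cyclically consecutive vertices; as the image of an embedding of the
circle it is automatically a simple closed curve. -/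
def IsPolygonalKnot {n : ℕ} (β : Sph 1 → Sph n) : Prop :=
  IsTopologicalKnot β ∧
    ∃ (k : ℕ) (P : Polygon (Euc n) k), Set.range β = stereoInv '' P.boundary ℝ

/-- A topological knot is tame if it is topologically equivalent to a polygonal knot. -/
def IsTame {n : ℕ} (α : Sph 1 → Sph n) : Prop :=
  IsTopologicalKnot α ∧
    ∃ β : Sph 1 → Sph n, IsPolygonalKnot β ∧ TopologicallyEquivalent α β

end

open Set Filter Topology

/-! ### Orientation-preserving homeomorphisms of the sphere -/

/-! A polygonal knot is only asked to trace a polygon, so it suffices to find an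
orientation-preserving homeomorphism of `Sⁿ` that carries the image of the completed knot onto a
closed polygon; the circle need not be reparametrized. The difficulty sits at the north pole, where
the completion may fail to be smooth.

Choose a nonconstant coordinate of the knot as height. Far out it is strictly monotone, so each end
is a graph over a half-line of heights. For odd degree the ends run in opposite directions and
shears straighten them independently. For even degree they share a direction; then some other
coordinate separates the points of equal height. Indeed, in the coordinate `1 / t` the partner of a
point is an analytic function, so the differences of coordinates are meromorphic, and by injectivity
they do not all vanish near `0` (`exists_eval_ne_of_even`). Shearing relative to one end then
straightens the other, in every dimension `n ≥ 2`. Rescaling the levels turns both ends into rays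
from one point (`IsPolynomialKnot.exists_radial_ends`).

A half-turn of the sphere, an inversion in the chart, brings the north pole to the origin. The rays
become segments there and the compact remainder a regular `C¹` arc. A fine inscribed polygon differs
from this arc by a displacement with small Lipschitz constant; extended by `0` over the two segments
and then to `ℝⁿ`, it is a contraction `v`, and `x ↦ x + v x` is a homeomorphism
(`exists_extendsOriented_inscribed`).

Orientation is controlled by homotopy alone: the maps of `ℝⁿ` are properly homotopic to the
identity, so they extend to `Sⁿ` fixing the north pole, and the half-turn is the end of a rotation.
-/

/-- A homeomorphism of the sphere that is homotopic to the identity preserves the orientation. -/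
theorem IsOrientationPreserving.of_homotopic {k : ℕ} {e : Sph k ≃ₜ Sph k}
    (h : (e : C(Sph k, Sph k)).Homotopic (ContinuousMap.id _)) : IsOrientationPreserving e := by
  obtain ⟨H⟩ := h
  have H' : TopCat.Homotopy (TopCat.ofHom (e : C(Sph k, Sph k))) (𝟙 (TopCat.of (Sph k))) := H
  have := H'.congr_homologyMap_singularChainComplexFunctor
    (C := ModuleCat.{0} ℤ) (ModuleCat.of ℤ ℤ) k
  refine Eq.trans this ?_
  exact ((AlgebraicTopology.singularHomologyFunctor (ModuleCat.{0} ℤ) k).obj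
    (ModuleCat.of ℤ ℤ)).map_id (TopCat.of (Sph k))

theorem IsOrientationPreserving.refl (k : ℕ) :
    IsOrientationPreserving (Homeomorph.refl (Sph k)) :=
  .of_homotopic (ContinuousMap.Homotopic.refl _)

theorem IsOrientationPreserving.trans {k : ℕ} {e f : Sph k ≃ₜ Sph k}
    (he : IsOrientationPreserving e) (hf : IsOrientationPreserving f) :
    IsOrientationPreserving (e.trans f) := by
  unfold IsOrientationPreserving at *
  have : TopCat.ofHom ((e.trans f : Sph k ≃ₜ Sph k) : C(Sph k, Sph k)) =
      TopCat.ofHom (e : C(Sph k, Sph k)) ≫ TopCat.ofHom (f : C(Sph k, Sph k)) := rfl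
  rw [this, Functor.map_comp, he, hf, Category.comp_id]

theorem IsOrientationPreserving.symm {k : ℕ} {e : Sph k ≃ₜ Sph k}
    (he : IsOrientationPreserving e) : IsOrientationPreserving e.symm := by
  unfold IsOrientationPreserving at *
  have : TopCat.ofHom (e : C(Sph k, Sph k)) ≫ TopCat.ofHom (e.symm : C(Sph k, Sph k)) =
      𝟙 (TopCat.of (Sph k)) := by
    ext x
    simp
  have h2 := congrArg (((AlgebraicTopology.singularHomologyFunctor (ModuleCat.{0} ℤ) k).obj
      (ModuleCat.of ℤ ℤ)).map) this
  rwa [Functor.map_comp, he, Category.id_comp, CategoryTheory.Functor.map_id] at h2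

/-! ### The sphere as a one-point compactification -/

section Stereographic

variable {n : ℕ}

@[simp]
theorem stereoInv_castSucc (x : Euc n) (i : Fin n) :
    (stereoInv x : Euc (n + 1)) i.castSucc = 2 * x i / (‖x‖ ^ 2 + 1) := by
  simp [stereoInv]

@[simp]
theorem stereoInv_last (x : Euc n) :
    (stereoInv x : Euc (n + 1)) (Fin.last n) = (‖x‖ ^ 2 - 1) / (‖x‖ ^ 2 + 1) := by
  simp [stereoInv]

@[simp]
theorem northPole_castSucc (i : Fin n) : (northPole n : Euc (n + 1)) i.castSucc = 0 := by
  simp [northPole]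

@[simp]
theorem northPole_last : (northPole n : Euc (n + 1)) (Fin.last n) = 1 := by
  simp [northPole]

theorem Sph.ext_coord {x y : Sph n} (h : ∀ i : Fin n, (x : Euc (n + 1)) i.castSucc =
    (y : Euc (n + 1)) i.castSucc)
    (hl : (x : Euc (n + 1)) (Fin.last n) = (y : Euc (n + 1)) (Fin.last n)) : x = y := by
  refine Subtype.ext (PiLp.ext fun i => ?_)
  induction i using Fin.lastCases with
  | last => exact hl
  | cast i => exact h i

theorem Sph.sum_sq (y : Sph n) :
    ∑ i : Fin n, (y : Euc (n + 1)) i.castSucc ^ 2 + (y : Euc (n + 1)) (Fin.last n) ^ 2 = 1 := by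
  rw [← Fin.sum_univ_castSucc (fun i => (y : Euc (n + 1)) i ^ 2), ← EuclideanSpace.real_norm_sq_eq,
    mem_sphere_zero_iff_norm.1 y.2, one_pow]

theorem Sph.eq_northPole_iff (y : Sph n) :
    y = northPole n ↔ (y : Euc (n + 1)) (Fin.last n) = 1 := by
  refine ⟨fun h => by rw [h, northPole_last], fun h => Sph.ext_coord (fun i => ?_) (by simp [h])⟩
  have hs := Sph.sum_sq y
  rw [h] at hs
  have h0 : ∑ i : Fin n, (y : Euc (n + 1)) i.castSucc ^ 2 = 0 := by linarith
  rw [Finset.sum_eq_zero_iff_of_nonneg (fun _ _ => sq_nonneg _)] at h0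
  simpa using h0 i (Finset.mem_univ i)

theorem one_sub_stereoInv_last (x : Euc n) :
    1 - (stereoInv x : Euc (n + 1)) (Fin.last n) = 2 / (‖x‖ ^ 2 + 1) := by
  have h : ‖x‖ ^ 2 + 1 ≠ 0 := by positivity
  rw [stereoInv_last]
  field_simp
  ring

theorem stereoInv_ne_northPole (x : Euc n) : stereoInv x ≠ northPole n := by
  rw [Ne, Sph.eq_northPole_iff]
  intro h
  have h1 := one_sub_stereoInv_last x
  rw [h, sub_self] at h1
  have : (0 : ℝ) < 2 / (‖x‖ ^ 2 + 1) := by positivity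
  linarith

theorem stereoInv_castSucc_div (x : Euc n) (i : Fin n) :
    (stereoInv x : Euc (n + 1)) i.castSucc / (1 - (stereoInv x : Euc (n + 1)) (Fin.last n)) =
      x i := by
  have h : ‖x‖ ^ 2 + 1 ≠ 0 := by positivity
  rw [one_sub_stereoInv_last, stereoInv_castSucc]
  field_simp

theorem stereoInv_injective : Function.Injective (stereoInv (n := n)) := by
  intro x y h
  ext i
  rw [← stereoInv_castSucc_div x i, h, stereoInv_castSucc_div]

theorem exists_stereoInv_eq {y : Sph n} (hy : y ≠ northPole n) : ∃ x, stereoInv x = y := by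
  have hl : 1 - (y : Euc (n + 1)) (Fin.last n) ≠ 0 := by
    intro h
    exact hy ((Sph.eq_northPole_iff y).2 (by linarith))
  have hs := Sph.sum_sq y
  set l := (y : Euc (n + 1)) (Fin.last n) with hldef
  let x : Euc n := WithLp.toLp 2 fun i => (y : Euc (n + 1)) i.castSucc / (1 - l)
  have hx : ‖x‖ ^ 2 = (1 + l) / (1 - l) := by
    rw [EuclideanSpace.real_norm_sq_eq]
    simp only [x, div_pow, ← Finset.sum_div]
    rw [show ∑ i : Fin n, (y : Euc (n + 1)) i.castSucc ^ 2 = (1 - l) * (1 + l) by linarith]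
    field_simp
  have hx1 : ‖x‖ ^ 2 + 1 = 2 / (1 - l) := by
    rw [hx]
    field_simp
    ring
  refine ⟨x, Sph.ext_coord (fun i => ?_) ?_⟩
  · rw [stereoInv_castSucc, hx1]
    simp only [x]
    field_simp
  · rw [stereoInv_last, hx1, hx]
    field_simp
    ring

theorem continuous_stereoInv : Continuous (stereoInv (n := n)) := by
  refine Continuous.subtype_mk ?_ _
  refine (PiLp.continuous_toLp 2 _).comp (continuous_pi fun i => ?_)
  have h : ∀ x : Euc n, ‖x‖ ^ 2 + 1 ≠ 0 := fun x => by positivity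
  induction i using Fin.lastCases with
  | last =>
    simp only [Fin.snoc_last]
    exact Continuous.div (by fun_prop) (by fun_prop) h
  | cast i =>
    simp only [Fin.snoc_castSucc]
    exact Continuous.div (by fun_prop) (by fun_prop) h

theorem dist_stereoInv_northPole_sq (x : Euc n) :
    dist (stereoInv x) (northPole n) ^ 2 = 4 / (‖x‖ ^ 2 + 1) := by
  have h : ‖x‖ ^ 2 + 1 ≠ 0 := by positivity
  have hs : ∑ i : Fin n, (x i) ^ 2 = ‖x‖ ^ 2 := (EuclideanSpace.real_norm_sq_eq x).symm
  rw [Subtype.dist_eq, dist_eq_norm, EuclideanSpace.real_norm_sq_eq, Fin.sum_univ_castSucc]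
  simp only [PiLp.sub_apply, stereoInv_castSucc, stereoInv_last, northPole_castSucc,
    northPole_last, sub_zero, div_pow, mul_pow, ← Finset.sum_div, ← Finset.mul_sum, hs]
  field_simp
  ring

theorem tendsto_stereoInv_cocompact :
    Tendsto (stereoInv (n := n)) (cocompact (Euc n)) (𝓝 (northPole n)) := by
  rw [tendsto_iff_dist_tendsto_zero]
  have h1 : Tendsto (fun x : Euc n => ‖x‖ ^ 2 + 1) (cocompact (Euc n)) atTop :=
    tendsto_atTop_add_const_right _ _
      ((tendsto_pow_atTop two_ne_zero).comp tendsto_norm_cocompact_atTop)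
  have h2 : Tendsto (fun x : Euc n => dist (stereoInv x) (northPole n) ^ 2) (cocompact (Euc n))
      (𝓝 0) := by
    simp_rw [dist_stereoInv_northPole_sq]
    exact h1.const_div_atTop 4
  have h3 := h2.sqrt
  simpa [Real.sqrt_sq dist_nonneg] using h3

/-- Stereographic projection as a homeomorphism `ℝⁿ ∪ {∞} ≃ Sⁿ`. -/
noncomputable def stereoHomeo (n : ℕ) : OnePoint (Euc n) ≃ₜ Sph n :=
  Continuous.homeoOfEquivCompactToT2
    (f := Equiv.ofBijective (fun p : OnePoint (Euc n) => p.elim (northPole n) stereoInv) (by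
      constructor
      · intro p q h
        induction p using OnePoint.rec <;> induction q using OnePoint.rec
        · rfl
        · exact absurd h.symm (stereoInv_ne_northPole _)
        · exact absurd h (stereoInv_ne_northPole _)
        · exact congrArg _ (stereoInv_injective h)
      · intro y
        by_cases hy : y = northPole n
        · exact ⟨OnePoint.infty, hy.symm⟩
        · obtain ⟨x, hx⟩ := exists_stereoInv_eq hy
          exact ⟨x, hx⟩))
    ((OnePoint.continuous_iff _).2 ⟨by
      rw [coclosedCompact_eq_cocompact]
      exact tendsto_stereoInv_cocompact, continuous_stereoInv⟩)

@[simp]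
theorem stereoHomeo_coe (x : Euc n) : stereoHomeo n (x : OnePoint (Euc n)) = stereoInv x := rfl

@[simp]
theorem stereoHomeo_infty : stereoHomeo n OnePoint.infty = northPole n := rfl

end Stereographic

/-! ### Extending homeomorphisms of Euclidean space to the sphere -/

section Extension

variable {n : ℕ}

/-- A homeomorphism of `ℝⁿ` extends to an orientation-preserving homeomorphism of `Sⁿ` that fixes
the north pole. -/
def ExtendsOriented (h : Euc n ≃ₜ Euc n) : Prop :=
  ∃ g : Sph n ≃ₜ Sph n, IsOrientationPreserving g ∧ g (northPole n) = northPole n ∧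
    ∀ x, g (stereoInv x) = stereoInv (h x)

theorem ExtendsOriented.trans {h k : Euc n ≃ₜ Euc n} (hh : ExtendsOriented h)
    (hk : ExtendsOriented k) : ExtendsOriented (h.trans k) := by
  obtain ⟨g, hg, hgn, hgx⟩ := hh
  obtain ⟨f, hf, hfn, hfx⟩ := hk
  exact ⟨g.trans f, hg.trans hf, by simp [hgn, hfn], fun x => by simp [hgx, hfx]⟩

/-- Continuity at `∞` must be uniform in the parameter. Joint properness provides this: the preimage
of a compact set is contained in a compact `L`, and the projection of `L` to `X` is a single compact
set that serves all parameters. -/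
theorem continuous_onePointMap_of_tendsto_cocompact {I X : Type*} [TopologicalSpace I]
    [CompactSpace I] [TopologicalSpace X] [T2Space X] {F : I × X → X} (hF : Continuous F)
    (hp : Tendsto F (cocompact (I × X)) (cocompact X)) :
    Continuous fun q : I × OnePoint X => OnePoint.map (fun x => F (q.1, x)) q.2 := by
  rw [continuous_iff_continuousAt]
  rintro ⟨s, p⟩
  induction p using OnePoint.rec with
  | infty =>
    rw [ContinuousAt, OnePoint.map_infty, OnePoint.hasBasis_nhds_infty.tendsto_right_iff]
    rintro K ⟨hKc, hK⟩
    obtain ⟨L, hL, hLK⟩ := mem_cocompact.1 (hp hK.compl_mem_cocompact)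
    have hK' : IsCompact (Prod.snd '' L) := hL.image continuous_snd
    have hmem : ∀ᶠ q : I × OnePoint X in 𝓝 (s, OnePoint.infty),
        q.2 ∈ (↑) '' (Prod.snd '' L)ᶜ ∪ {OnePoint.infty} :=
      continuous_snd.continuousAt.eventually_mem
        (OnePoint.hasBasis_nhds_infty.mem_of_mem ⟨hK'.isClosed, hK'⟩)
    filter_upwards [hmem]
    rintro ⟨u, q⟩ hq
    rcases hq with ⟨x, hx, rfl⟩ | hq
    · left
      exact ⟨F (u, x), hLK fun h => hx ⟨(u, x), h, rfl⟩, rfl⟩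
    · right
      rw [mem_singleton_iff] at hq
      dsimp only at hq
      simp [hq]
  | coe x =>
    have he : IsOpenEmbedding (Prod.map id ((↑) : X → OnePoint X) : I × X → I × OnePoint X) :=
      IsOpenEmbedding.id.prodMap OnePoint.isOpenEmbedding_coe
    have : ((s, (x : OnePoint X)) : I × OnePoint X) = Prod.map id (↑) (s, x) := rfl
    rw [this, ← he.continuousAt_iff]
    exact (OnePoint.continuous_coe.comp hF).continuousAt

/-- A homeomorphism of `ℝⁿ` that is properly homotopic to the identity extends to the sphere as
an orientation-preserving homeomorphism. -/
theorem ExtendsOriented.of_proper_homotopy (h : Euc n ≃ₜ Euc n)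
    (F : unitInterval × Euc n → Euc n) (hF : Continuous F)
    (hp : Tendsto F (cocompact (unitInterval × Euc n)) (cocompact (Euc n)))
    (h0 : ∀ x, F (0, x) = x) (h1 : ∀ x, F (1, x) = h x) : ExtendsOriented h := by
  refine ⟨((stereoHomeo n).symm.trans h.onePointCongr).trans (stereoHomeo n), ?_, ?_, ?_⟩
  · refine .of_homotopic (ContinuousMap.Homotopic.symm ⟨⟨⟨fun q => stereoHomeo n
      (OnePoint.map (fun x => F (q.1, x)) ((stereoHomeo n).symm q.2)), ?_⟩, ?_, ?_⟩⟩)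
    · exact (stereoHomeo n).continuous.comp
        ((continuous_onePointMap_of_tendsto_cocompact hF hp).comp
          (continuous_fst.prodMk ((stereoHomeo n).symm.continuous.comp continuous_snd)))
    · intro y
      have : (fun x => F (0, x)) = id := funext h0
      simp [this]
    · intro y
      have : (fun x => F (1, x)) = h := funext h1
      simp only [this]
      rfl
  · have : (stereoHomeo n).symm (northPole n) = OnePoint.infty := by
      rw [Homeomorph.symm_apply_eq, stereoHomeo_infty]
    simp only [Homeomorph.trans_apply, this]
    rfl
  · intro x
    have : (stereoHomeo n).symm (stereoInv x) = (x : OnePoint (Euc n)) := by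
      rw [Homeomorph.symm_apply_eq, stereoHomeo_coe]
    simp only [Homeomorph.trans_apply, this]
    rfl

/-- An isotopy `F` of `ℝⁿ` with inverse `G` that starts at the identity ends in a homeomorphism that
extends to the sphere as an orientation-preserving homeomorphism. -/
theorem exists_extendsOriented_of_isotopy (F G : unitInterval × Euc n → Euc n)
    (hF : Continuous F) (hG : Continuous G) (hGF : ∀ s x, G (s, F (s, x)) = x)
    (hFG : ∀ x, F (1, G (1, x)) = x) (h0 : ∀ x, F (0, x) = x) :
    ∃ h : Euc n ≃ₜ Euc n, ExtendsOriented h ∧ ∀ x, h x = F (1, x) := by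
  let h : Euc n ≃ₜ Euc n :=
    { toFun := fun x => F (1, x)
      invFun := fun x => G (1, x)
      left_inv := fun x => hGF 1 x
      right_inv := fun x => hFG x
      continuous_toFun := hF.comp (by fun_prop)
      continuous_invFun := hG.comp (by fun_prop) }
  refine ⟨h, .of_proper_homotopy h F hF ?_ h0 (fun _ => rfl), fun _ => rfl⟩
  -- If `F (s, x)` lies in `K`, then `x = G (s, F (s, x))` lies in the compact set `G '' (univ ×ˢ
  -- K)`; so only the left inverse matters at intermediate times.
  rw [hasBasis_cocompact.tendsto_right_iff]
  intro K hK
  refine mem_cocompact.2 ⟨univ ×ˢ (G '' (univ ×ˢ K)),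
    isCompact_univ.prod ((isCompact_univ.prod hK).image hG), ?_⟩
  rintro ⟨s, x⟩ hx hF
  exact hx ⟨mem_univ _, (s, F (s, x)), ⟨mem_univ _, hF⟩, hGF s x⟩

/-- The homeomorphism `x ↦ x + v x` for a contraction `v`. -/
theorem exists_extendsOriented_of_lipschitz {v : Euc n → Euc n} {c : NNReal}
    (hv : LipschitzWith c v) (hc : c < 1) :
    ∃ h : Euc n ≃ₜ Euc n, ExtendsOriented h ∧ ∀ x, h x = x + v x := by
  have hg : ApproximatesLinearOn (fun x => x + v x)
      ((ContinuousLinearEquiv.refl ℝ (Euc n) : Euc n ≃L[ℝ] Euc n) : Euc n →L[ℝ] Euc n) univ c := by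
    apply LipschitzOnWith.approximatesLinearOn
    rw [lipschitzOnWith_univ]
    have : (fun x => x + v x) - ((ContinuousLinearEquiv.refl ℝ (Euc n) : Euc n ≃L[ℝ] Euc n) :
        Euc n →L[ℝ] Euc n) = v := by
      ext x
      simp
    rw [this]
    exact hv
  have hc' : Subsingleton (Euc n) ∨ c < ‖((ContinuousLinearEquiv.refl ℝ (Euc n)).symm :
      Euc n →L[ℝ] Euc n)‖₊⁻¹ := by
    rcases subsingleton_or_nontrivial (Euc n) with hs | hs
    · exact Or.inl hs
    · right
      have : ‖((ContinuousLinearEquiv.refl ℝ (Euc n)).symm : Euc n →L[ℝ] Euc n)‖₊ = 1 := by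
        ext
        simp
      rw [this, inv_one]
      exact hc
  refine ⟨hg.toHomeomorph _ hc', .of_proper_homotopy _ (fun q => q.2 + (q.1 : ℝ) • v q.2) ?_ ?_ ?_
    ?_, fun _ => rfl⟩
  · have := hv.continuous
    fun_prop
  · have hc1 : (0 : ℝ) < 1 - c := sub_pos.2 (by exact_mod_cast hc)
    -- Since `c < 1`, the contraction cannot cancel the growth of `x`; this makes the straight-line
    -- homotopy proper.
    have hbound : ∀ q : unitInterval × Euc n,
        (1 - c) * ‖q.2‖ - ‖v 0‖ ≤ ‖q.2 + (q.1 : ℝ) • v q.2‖ := by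
      rintro ⟨s, x⟩
      have h1 : ‖v x‖ ≤ c * ‖x‖ + ‖v 0‖ := by
        have := hv.norm_sub_le x 0
        rw [sub_zero] at this
        linarith [norm_le_norm_add_norm_sub' (v x) (v 0)]
      have h2 : ‖(s : ℝ) • v x‖ ≤ ‖v x‖ := by
        rw [norm_smul, Real.norm_of_nonneg s.2.1]
        exact mul_le_of_le_one_left (norm_nonneg _) s.2.2
      have h3 := norm_sub_le (x + (s : ℝ) • v x) ((s : ℝ) • v x)
      rw [add_sub_cancel_right] at h3
      dsimp only
      linarith
    have hsnd : Tendsto (fun q : unitInterval × Euc n => q.2) (cocompact _) (cocompact _) := by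
      rw [hasBasis_cocompact.tendsto_right_iff]
      intro K hK
      refine mem_cocompact.2 ⟨univ ×ˢ K, isCompact_univ.prod hK, ?_⟩
      rintro ⟨s, x⟩ hx hxK
      exact hx ⟨mem_univ _, hxK⟩
    rw [← Metric.cobounded_eq_cocompact (α := Euc n), ← tendsto_norm_atTop_iff_cobounded]
    refine tendsto_atTop_mono hbound ?_
    refine tendsto_atTop_add_const_right _ _ (Tendsto.const_mul_atTop hc1 ?_)
    exact tendsto_norm_cocompact_atTop.comp hsnd
  · simp
  · intro x
    rw [Icc.coe_one, one_smul]
    rfl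

/-- Two families of points whose difference is a small Lipschitz function of one of them are
related by a homeomorphism of the ambient space. -/
theorem exists_extendsOriented_of_lipschitz_family {ι : Type*} (P Γ : ι → Euc n) (c : NNReal)
    (hc : lipschitzExtensionConstant (Euc n) * c < 1)
    (h : ∀ i j, ‖(Γ i - P i) - (Γ j - P j)‖ ≤ c * ‖P i - P j‖) :
    ∃ e : Euc n ≃ₜ Euc n, ExtendsOriented e ∧ ∀ i, e (P i) = Γ i := by
  classical
  -- The chosen index is immaterial: `h` forces equal displacements wherever the points `P i`
  -- coincide.
  let u : Euc n → Euc n := fun x =>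
    if hx : ∃ i, P i = x then Γ hx.choose - P hx.choose else 0
  have hu : ∀ i, u (P i) = Γ i - P i := by
    intro i
    have hx : ∃ j, P j = P i := ⟨i, rfl⟩
    have h1 := h hx.choose i
    rw [hx.choose_spec, sub_self, norm_zero, mul_zero, norm_le_zero_iff, sub_eq_zero] at h1
    simp only [u, dif_pos hx]
    rw [hx.choose_spec, h1]
  have hL : LipschitzOnWith c u (range P) := by
    rw [lipschitzOnWith_iff_norm_sub_le]
    rintro _ ⟨i, rfl⟩ _ ⟨j, rfl⟩
    rw [hu, hu]
    exact h i j
  -- The extension costs the factor `lipschitzExtensionConstant`, which `hc` has allowed for, so `v`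
  -- is a contraction.
  obtain ⟨v, hv, hvu⟩ := hL.extend_finite_dimension
  obtain ⟨e, he, hev⟩ := exists_extendsOriented_of_lipschitz hv hc
  refine ⟨e, he, fun i => ?_⟩
  rw [hev, ← hvu (mem_range_self i), hu, add_sub_cancel]

end Extension

/-! ### The half-turn of the sphere -/

section HalfTurn

variable {n : ℕ}

theorem norm_rotation_sq (x : Euc (n + 1)) (i : Fin (n + 1)) (hi : i ≠ Fin.last n) (a b : ℝ)
    (hab : a ^ 2 + b ^ 2 = 1) :
    ‖x + ((a - 1) * x i - b * x (Fin.last n)) • EuclideanSpace.single i (1 : ℝ) +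
      (b * x i + (a - 1) * x (Fin.last n)) • EuclideanSpace.single (Fin.last n) (1 : ℝ)‖ ^ 2 =
      ‖x‖ ^ 2 := by
  rw [← real_inner_self_eq_norm_sq, ← real_inner_self_eq_norm_sq]
  simp only [inner_add_left, inner_add_right, inner_smul_left, inner_smul_right,
    EuclideanSpace.inner_single_left, EuclideanSpace.inner_single_right]
  simp [hi, hi.symm]
  linear_combination (x i ^ 2 + x (Fin.last n) ^ 2) * hab

/-- The half-turn of the sphere in the plane of the `i`-th and the last coordinate: in the
stereographic chart it is the inversion in the unit sphere followed by a reflection. -/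
theorem exists_halfTurn (i : Fin n) :
    ∃ (g : Sph n ≃ₜ Sph n) (ρ : Euc n ≃ₗᵢ[ℝ] Euc n), IsOrientationPreserving g ∧
      g (northPole n) = stereoInv 0 ∧
      ∀ x, x ≠ 0 → g (stereoInv x) = stereoInv ((1 / ‖x‖) ^ 2 • ρ x) := by
  have hi : i.castSucc ≠ Fin.last n := (Fin.castSucc_lt_last i).ne
  -- Rotation by `θ` in the plane of the two coordinates; letting `θ` run from `0` to `π` joins the
  -- identity to the half-turn.
  let r : ℝ → Euc (n + 1) → Euc (n + 1) := fun θ x =>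
    x + ((Real.cos θ - 1) * x i.castSucc - Real.sin θ * x (Fin.last n)) •
        EuclideanSpace.single i.castSucc (1 : ℝ) +
      (Real.sin θ * x i.castSucc + (Real.cos θ - 1) * x (Fin.last n)) •
        EuclideanSpace.single (Fin.last n) (1 : ℝ)
  have hr : ∀ θ x, x ∈ Metric.sphere (0 : Euc (n + 1)) 1 →
      r θ x ∈ Metric.sphere (0 : Euc (n + 1)) 1 := by
    intro θ x hx
    rw [mem_sphere_zero_iff_norm] at hx ⊢
    have := norm_rotation_sq x _ hi _ _ (Real.cos_sq_add_sin_sq θ)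
    rw [hx, one_pow] at this
    exact (pow_eq_one_iff_of_nonneg (norm_nonneg _) two_ne_zero).1 this
  have hrc : Continuous fun q : ℝ × Euc (n + 1) => r q.1 q.2 := by
    have h1 : ∀ k, Continuous fun q : ℝ × Euc (n + 1) => q.2 k := fun k => by fun_prop
    have h2 : Continuous fun q : ℝ × Euc (n + 1) => Real.cos q.1 := by fun_prop
    have h3 : Continuous fun q : ℝ × Euc (n + 1) => Real.sin q.1 := by fun_prop
    have h4 := ((h2.sub (continuous_const (y := (1 : ℝ)))).mul (h1 i.castSucc)).sub (h3.mul (h1 (Fin.last n)))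
    have h5 := (h3.mul (h1 i.castSucc)).add ((h2.sub (continuous_const (y := (1 : ℝ)))).mul (h1 (Fin.last n)))
    exact (continuous_snd.add (h4.smul continuous_const)).add (h5.smul continuous_const)
  have hpi : ∀ x : Euc (n + 1), r Real.pi x = x + (-2 * x i.castSucc) •
      EuclideanSpace.single i.castSucc (1 : ℝ) + (-2 * x (Fin.last n)) •
      EuclideanSpace.single (Fin.last n) (1 : ℝ) := by
    intro x
    simp only [r, Real.cos_pi, Real.sin_pi]
    norm_num
  have hinv : ∀ x, r Real.pi (r Real.pi x) = x := by
    intro x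
    ext k
    rw [hpi, hpi]
    simp only [PiLp.add_apply, PiLp.smul_apply, smul_eq_mul, PiLp.single_apply]
    split_ifs <;> simp_all <;> ring
  let g : Sph n ≃ₜ Sph n :=
    { toFun := fun y => ⟨r Real.pi y, hr _ _ y.2⟩
      invFun := fun y => ⟨r Real.pi y, hr _ _ y.2⟩
      left_inv := fun y => Subtype.ext (hinv y)
      right_inv := fun y => Subtype.ext (hinv y)
      continuous_toFun := Continuous.subtype_mk
        (hrc.comp (continuous_const.prodMk continuous_subtype_val)) _
      continuous_invFun := Continuous.subtype_mk
        (hrc.comp (continuous_const.prodMk continuous_subtype_val)) _ }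
  -- The half-turn negates two coordinates of the sphere: negating the last one is the inversion in
  -- the chart, negating the other one is the reflection `ρ`.
  let ρ : Euc n ≃ₗᵢ[ℝ] Euc n :=
    LinearIsometryEquiv.piLpCongrRight 2 fun k =>
      if k = i then LinearIsometryEquiv.neg ℝ else LinearIsometryEquiv.refl ℝ ℝ
  have hρ : ∀ x k, ρ x k = if k = i then - x k else x k := by
    intro x k
    simp only [ρ, LinearIsometryEquiv.piLpCongrRight_apply]
    split_ifs <;> rfl
  refine ⟨g, ρ, .of_homotopic (ContinuousMap.Homotopic.symm ⟨⟨⟨fun q =>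
    ⟨r (q.1 * Real.pi) q.2, hr _ _ q.2.2⟩, ?_⟩, ?_, ?_⟩⟩), ?_, ?_⟩
  · exact Continuous.subtype_mk (hrc.comp (Continuous.prodMk (by fun_prop) (by fun_prop))) _
  · intro y
    apply Subtype.ext
    simp [r]
  · intro y
    apply Subtype.ext
    simp only [Icc.coe_one, one_mul]
    rfl
  · refine Sph.ext_coord (fun k => ?_) ?_
    · change r Real.pi _ _ = _
      rw [hpi]
      simp [(Fin.castSucc_lt_last k).ne]
    · change r Real.pi _ _ = _
      rw [hpi]
      simp
      norm_num
  · intro x hx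
    have hx0 : ‖x‖ ≠ 0 := norm_ne_zero_iff.2 hx
    have hn : ‖(1 / ‖x‖) ^ 2 • ρ x‖ = 1 / ‖x‖ := by
      rw [norm_smul, ρ.norm_map, Real.norm_of_nonneg (by positivity)]
      field_simp
    have hp : ‖x‖ ^ 2 + 1 ≠ 0 := by positivity
    have hp' : 1 + ‖x‖ ^ 2 ≠ 0 := by positivity
    refine Sph.ext_coord (fun k => ?_) ?_
    · change r Real.pi _ _ = _
      rw [hpi, stereoInv_castSucc ((1 / ‖x‖) ^ 2 • ρ x), hn]
      simp only [PiLp.add_apply, PiLp.smul_apply, smul_eq_mul, PiLp.single_apply,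
        stereoInv_castSucc, hρ, Fin.castSucc_inj, (Fin.castSucc_lt_last k).ne, if_false]
      split_ifs with h
      · subst h
        field_simp
        ring
      · field_simp
        ring
    · change r Real.pi _ _ = _
      rw [hpi, stereoInv_last ((1 / ‖x‖) ^ 2 • ρ x), hn]
      simp only [PiLp.add_apply, PiLp.smul_apply, smul_eq_mul, PiLp.single_apply,
        stereoInv_last, hi.symm, if_false, if_true]
      field_simp
      ring

end HalfTurn

/-! ### Polygonal approximation of differentiable arcs -/

section Arc

variable {E : Type*} [NormedAddCommGroup E] [NormedSpace ℝ E]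

/-- A continuously differentiable arc is uniformly differentiable. -/
theorem exists_uniform_deriv_bound {Γ Γ' : ℝ → E} {a b : ℝ}
    (hΓ : ∀ t ∈ Icc a b, HasDerivAt Γ (Γ' t) t) (hc : ContinuousOn Γ' (Icc a b)) {ε : ℝ}
    (hε : 0 < ε) :
    ∃ η > 0, ∀ u ∈ Icc a b, ∀ w ∈ Icc a b, |w - u| ≤ η → ∀ s ∈ uIcc u w, ∀ t ∈ uIcc u w,
      ‖Γ t - Γ s - (t - s) • Γ' u‖ ≤ ε * |t - s| := by
  have huc := isCompact_Icc.uniformContinuousOn_of_continuous hc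
  rw [Metric.uniformContinuousOn_iff_le] at huc
  obtain ⟨η, hη, h⟩ := huc ε hε
  refine ⟨η, hη, fun u hu w hw huw s hs t ht => ?_⟩
  have hsub : uIcc u w ⊆ Icc a b := uIcc_subset_Icc hu hw
  have key := (convex_uIcc u w).norm_image_sub_le_of_norm_hasDerivWithin_le
    (f := fun x => Γ x - x • Γ' u) (f' := fun x => Γ' x - (1 : ℝ) • Γ' u) (C := ε)
    (fun x hx => ((hΓ x (hsub hx)).sub ((hasDerivAt_id x).smul_const (Γ' u))).hasDerivWithinAt)
    (fun x hx => by
      rw [one_smul, ← dist_eq_norm]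
      refine h x (hsub hx) u hu ?_
      rw [Real.dist_eq]
      have := abs_sub_left_of_mem_uIcc hx
      exact this.trans huw) hs ht
  rw [Real.norm_eq_abs] at key
  convert key using 2
  rw [sub_smul]
  abel

/-- An injective, continuously differentiable arc without critical points expands distances up to
a constant. -/
theorem exists_lower_lipschitz_bound {Γ Γ' : ℝ → E} {a b : ℝ}
    (hΓ : ∀ t ∈ Icc a b, HasDerivAt Γ (Γ' t) t) (hc : ContinuousOn Γ' (Icc a b))
    (hinj : InjOn Γ (Icc a b)) (h0 : ∀ t ∈ Icc a b, Γ' t ≠ 0) :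
    ∃ m > 0, ∀ s ∈ Icc a b, ∀ t ∈ Icc a b, m * |s - t| ≤ ‖Γ s - Γ t‖ := by
  rcases (Icc a b).eq_empty_or_nonempty with he | hne
  · exact ⟨1, one_pos, by simp [he]⟩
  obtain ⟨t₀, ht₀, hmin⟩ := isCompact_Icc.exists_isMinOn hne hc.norm
  have hμ : 0 < ‖Γ' t₀‖ / 2 := by
    have := norm_pos_iff.2 (h0 t₀ ht₀)
    linarith
  obtain ⟨η, hη, hu⟩ := exists_uniform_deriv_bound hΓ hc hμ
  have hclose : ∀ s ∈ Icc a b, ∀ t ∈ Icc a b, |s - t| ≤ η →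
      ‖Γ' t₀‖ / 2 * |s - t| ≤ ‖Γ s - Γ t‖ := by
    intro s hs t ht hst
    have h1 := hu t ht s hs hst t left_mem_uIcc s right_mem_uIcc
    have h2 : ‖Γ' t₀‖ ≤ ‖Γ' t‖ := hmin ht
    have h3 : ‖(s - t) • Γ' t‖ ≤ ‖Γ s - Γ t‖ + ‖Γ s - Γ t - (s - t) • Γ' t‖ := by
      have := norm_sub_le (Γ s - Γ t) (Γ s - Γ t - (s - t) • Γ' t)
      rwa [sub_sub_cancel] at this
    rw [norm_smul, Real.norm_eq_abs] at h3
    nlinarith [abs_nonneg (s - t), mul_le_mul_of_nonneg_left h2 (abs_nonneg (s - t))]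
  -- Close pairs are controlled by the minimal speed; the remaining ones form a compact set, on
  -- which injectivity keeps the distance away from `0`.
  let A : Set (ℝ × ℝ) := (Icc a b ×ˢ Icc a b) ∩ {q | η ≤ |q.1 - q.2|}
  have hA : IsCompact A := (isCompact_Icc.prod isCompact_Icc).inter_right
    (isClosed_le continuous_const (by fun_prop))
  have hΓc : ContinuousOn Γ (Icc a b) := fun t ht => (hΓ t ht).continuousAt.continuousWithinAt
  have hfc : ContinuousOn (fun q : ℝ × ℝ => ‖Γ q.1 - Γ q.2‖) A := by
    refine ContinuousOn.norm (ContinuousOn.sub ?_ ?_)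
    · exact hΓc.comp continuous_fst.continuousOn fun q hq => hq.1.1
    · exact hΓc.comp continuous_snd.continuousOn fun q hq => hq.1.2
  obtain ⟨d, hd, hfar⟩ : ∃ d > 0, ∀ q ∈ A, d ≤ ‖Γ q.1 - Γ q.2‖ := by
    rcases A.eq_empty_or_nonempty with hAe | hAne
    · exact ⟨1, one_pos, by simp [hAe]⟩
    · obtain ⟨q, hq, hqmin⟩ := hA.exists_isMinOn hAne hfc
      refine ⟨_, norm_pos_iff.2 (sub_ne_zero.2 fun h => ?_), fun x hx => hqmin hx⟩
      have h1 := hinj hq.1.1 hq.1.2 h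
      have h2 : η ≤ |q.1 - q.2| := hq.2
      rw [h1, sub_self, abs_zero] at h2
      linarith
  have hab : 0 ≤ b - a := by
    obtain ⟨x, hx⟩ := hne
    linarith [hx.1, hx.2]
  refine ⟨min (‖Γ' t₀‖ / 2) (d / (b - a + 1)), lt_min hμ (by positivity), fun s hs t ht => ?_⟩
  rcases le_total (|s - t|) η with h | h
  · exact (mul_le_mul_of_nonneg_right (min_le_left _ _) (abs_nonneg _)).trans (hclose s hs t ht h)
  · refine le_trans ?_ (hfar (s, t) ⟨⟨hs, ht⟩, h⟩)
    have h1 : |s - t| ≤ b - a + 1 := by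
      rw [abs_le]
      constructor <;> linarith [hs.1, hs.2, ht.1, ht.2]
    calc min (‖Γ' t₀‖ / 2) (d / (b - a + 1)) * |s - t|
        ≤ d / (b - a + 1) * (b - a + 1) := by
          gcongr
          exact min_le_right _ _
      _ = d := by field_simp

/-- The deviation of a function on `[u, w]` from its linear interpolation is a Lipschitz function
with a small constant if the function is nearly linear. -/
theorem norm_sub_lineMap_sub_le {Γ : ℝ → E} {D : E} {u w ε : ℝ}
    (h : ∀ s ∈ uIcc u w, ∀ t ∈ uIcc u w, ‖Γ t - Γ s - (t - s) • D‖ ≤ ε * |t - s|)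
    {r r' : ℝ} (hr : r ∈ Icc (0 : ℝ) 1) (hr' : r' ∈ Icc (0 : ℝ) 1) :
    ‖(Γ (AffineMap.lineMap u w r) - AffineMap.lineMap (Γ u) (Γ w) r) -
      (Γ (AffineMap.lineMap u w r') - AffineMap.lineMap (Γ u) (Γ w) r')‖ ≤
      2 * ε * |AffineMap.lineMap u w r - AffineMap.lineMap u w r'| := by
  have hmem : ∀ x ∈ Icc (0 : ℝ) 1, AffineMap.lineMap u w x ∈ uIcc u w := by
    intro x hx
    rw [← segment_eq_uIcc, segment_eq_image_lineMap]
    exact mem_image_of_mem _ hx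
  have h1 := h _ (hmem r' hr') _ (hmem r hr)
  have h2 := h u left_mem_uIcc w right_mem_uIcc
  have hdiff : (AffineMap.lineMap u w r : ℝ) - AffineMap.lineMap u w r' = (r - r') * (w - u) := by
    simp only [AffineMap.lineMap_apply, vsub_eq_sub, smul_eq_mul, vadd_eq_add]
    ring
  -- The linear terms cancel. What remains is the error of the approximation between the two
  -- parameters and `r - r'` times the error over all of `[u, w]`; each contributes one `ε`.
  have heq : (Γ (AffineMap.lineMap u w r) - AffineMap.lineMap (Γ u) (Γ w) r) -
      (Γ (AffineMap.lineMap u w r') - AffineMap.lineMap (Γ u) (Γ w) r') =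
      (Γ (AffineMap.lineMap u w r) - Γ (AffineMap.lineMap u w r') -
        ((r - r') * (w - u)) • D) - (r - r') • (Γ w - Γ u - (w - u) • D) := by
    simp only [AffineMap.lineMap_apply, vsub_eq_sub, vadd_eq_add]
    module
  rw [hdiff] at h1 ⊢
  rw [heq]
  refine (norm_sub_le _ _).trans ?_
  rw [norm_smul, Real.norm_eq_abs]
  have h3 := mul_le_mul_of_nonneg_left h2 (abs_nonneg (r - r'))
  rw [abs_mul] at h1 ⊢
  linarith

end Arc

/-! ### Replacing an arc by an inscribed polygon. -/

section Inscribed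

/-- The `k`-th point of the partition of `[a, b]` into `N` intervals of equal length. -/
noncomputable def partitionPoint (a b : ℝ) (N k : ℕ) : ℝ := a + k * ((b - a) / N)

theorem partitionPoint_zero (a b : ℝ) (N : ℕ) : partitionPoint a b N 0 = a := by
  simp [partitionPoint]

theorem partitionPoint_self (a b : ℝ) {N : ℕ} (hN : 0 < N) : partitionPoint a b N N = b := by
  have : (N : ℝ) ≠ 0 := by positivity
  rw [partitionPoint]
  field_simp
  ring

theorem partitionPoint_mono {a b : ℝ} (hab : a ≤ b) (N : ℕ) : Monotone (partitionPoint a b N) := by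
  intro k l hkl
  have : 0 ≤ (b - a) / N := div_nonneg (by linarith) (Nat.cast_nonneg _)
  unfold partitionPoint
  gcongr

theorem partitionPoint_succ_sub (a b : ℝ) (N k : ℕ) :
    partitionPoint a b N (k + 1) - partitionPoint a b N k = (b - a) / N := by
  simp only [partitionPoint]
  push_cast
  ring

theorem exists_mem_partition {a b : ℝ} {N : ℕ} (hN : 0 < N) {t : ℝ} (ht : t ∈ Icc a b) :
    ∃ k < N, t ∈ Icc (partitionPoint a b N k) (partitionPoint a b N (k + 1)) := by
  have key : ∀ M, t ≤ partitionPoint a b N (M + 1) →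
      ∃ k ≤ M, t ∈ Icc (partitionPoint a b N k) (partitionPoint a b N (k + 1)) := by
    intro M
    induction M with
    | zero => exact fun h => ⟨0, le_rfl, by rw [partitionPoint_zero]; exact ht.1, h⟩
    | succ M ih =>
      intro h
      rcases le_total (partitionPoint a b N (M + 1)) t with h' | h'
      · exact ⟨M + 1, le_rfl, h', h⟩
      · obtain ⟨k, hk, hk'⟩ := ih h'
        exact ⟨k, hk.trans (Nat.le_succ M), hk'⟩
  obtain ⟨M, rfl⟩ := Nat.exists_eq_succ_of_ne_zero hN.ne'
  obtain ⟨k, hk, hk'⟩ := key M (by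
    rw [Nat.succ_eq_add_one, partitionPoint_self a b (Nat.succ_pos M)]; exact ht.2)
  exact ⟨k, Nat.lt_succ_of_le hk, hk'⟩

/-- A continuously differentiable arc can be replaced by an inscribed polygonal arc by means of a
homeomorphism of the ambient space that fixes a given set `S`, provided that `S` is not tangent to
the arc in its end points. -/
theorem exists_extendsOriented_inscribed {n : ℕ} {Γ Γ' : ℝ → Euc n} {a b m : ℝ} {S : Set (Euc n)}
    (hab : a ≤ b) (hΓ : ∀ t ∈ Icc a b, HasDerivAt Γ (Γ' t) t) (hc : ContinuousOn Γ' (Icc a b))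
    (hm : 0 < m) (hlow : ∀ s ∈ Icc a b, ∀ t ∈ Icc a b, m * |s - t| ≤ ‖Γ s - Γ t‖)
    (hS : ∀ t ∈ Icc a b, ∀ x ∈ S, m * min (t - a) (b - t) ≤ ‖Γ t - x‖) :
    ∃ (N : ℕ) (e : Euc n ≃ₜ Euc n), 0 < N ∧ ExtendsOriented e ∧ (∀ x ∈ S, e x = x) ∧
      e '' (⋃ k < N, segment ℝ (Γ (partitionPoint a b N k)) (Γ (partitionPoint a b N (k + 1)))) =
        Γ '' Icc a b := by
  set K : ℝ := ((lipschitzExtensionConstant (Euc n) : NNReal) : ℝ) with hK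
  have hK0 : 0 < K := lipschitzExtensionConstant_pos (Euc n)
  -- With this `δ` the constant `c = δ / (m - δ)` below equals `1 / (2 * K + 1)`, whence `K * c <
  -- 1`.
  set δ : ℝ := m / (2 * K + 2) with hδ
  have hδ0 : 0 < δ := by positivity
  obtain ⟨η, hη, hu⟩ := exists_uniform_deriv_bound hΓ hc (half_pos hδ0)
  obtain ⟨N, hN⟩ := exists_nat_gt ((b - a) / η)
  have hN0 : 0 < N := by
    have : (0 : ℝ) < N := lt_of_le_of_lt (div_nonneg (by linarith) hη.le) hN
    exact_mod_cast this
  have hNη : (b - a) / N ≤ η := by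
    rw [div_lt_iff₀ hη] at hN
    rw [div_le_iff₀ (by positivity)]
    linarith
  set p := partitionPoint a b N with hp
  have hmono : Monotone p := partitionPoint_mono hab N
  have hpmem : ∀ k ≤ N, p k ∈ Icc a b := fun k hk =>
    ⟨(partitionPoint_zero a b N).symm.le.trans (hmono (Nat.zero_le k)),
      (hmono hk).trans (partitionPoint_self a b hN0).le⟩
  let τ : Fin N × Icc (0 : ℝ) 1 → ℝ := fun q =>
    AffineMap.lineMap (p q.1) (p (q.1 + 1)) (q.2 : ℝ)
  let Q : Fin N × Icc (0 : ℝ) 1 → Euc n := fun q =>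
    AffineMap.lineMap (Γ (p q.1)) (Γ (p (q.1 + 1))) (q.2 : ℝ)
  let f : Fin N × Icc (0 : ℝ) 1 → Euc n := fun q => Γ (τ q) - Q q
  have hτ : ∀ q : Fin N × Icc (0 : ℝ) 1, τ q ∈ Icc (p q.1) (p (q.1 + 1)) := by
    intro q
    rw [← segment_eq_Icc (hmono (Nat.le_succ _)), segment_eq_image_lineMap]
    exact mem_image_of_mem _ q.2.2
  have hτab : ∀ q, τ q ∈ Icc a b := fun q =>
    ⟨(hpmem _ q.1.2.le).1.trans (hτ q).1, (hτ q).2.trans (hpmem _ q.1.2).2⟩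
  have hsame : ∀ (k : Fin N) (r r' : Icc (0 : ℝ) 1),
      ‖f (k, r) - f (k, r')‖ ≤ δ * |τ (k, r) - τ (k, r')| := by
    intro k r r'
    have h1 := norm_sub_lineMap_sub_le (hu (p k) (hpmem _ k.2.le) (p (k + 1)) (hpmem _ k.2) (by
      rw [hp, partitionPoint_succ_sub, abs_of_nonneg (div_nonneg (by linarith) (by positivity))]
      exact hNη)) r.2 r'.2
    calc _ ≤ _ := h1
      _ = _ := by
        rw [mul_div_cancel₀ δ (two_ne_zero)]
  have hf0 : ∀ k, f (k, 0) = 0 := fun k => by simp [f, τ, Q]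
  have hf1 : ∀ k, f (k, 1) = 0 := fun k => by simp [f, τ, Q]
  have hτ0 : ∀ k, τ (k, 0) = p k := fun k => by simp [τ]
  have hτ1 : ∀ k : Fin N, τ (k, 1) = p (k + 1) := fun k => by simp [τ]
  have hleft : ∀ q : Fin N × Icc (0 : ℝ) 1, ‖f q‖ ≤ δ * (τ q - p q.1) := by
    rintro ⟨k, r⟩
    have := hsame k r 0
    rwa [hf0, sub_zero, hτ0, abs_of_nonneg (sub_nonneg.2 (hτ (k, r)).1)] at this
  have hright : ∀ q : Fin N × Icc (0 : ℝ) 1, ‖f q‖ ≤ δ * (p (q.1 + 1) - τ q) := by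
    rintro ⟨k, r⟩
    have := hsame k r 1
    rwa [hf1, sub_zero, hτ1, abs_sub_comm, abs_of_nonneg (sub_nonneg.2 (hτ (k, r)).2)] at this
  -- The displacement `f` vanishes at the vertices. For points on different edges it is therefore
  -- bounded by the distance to a vertex in between, and these two bounds add up to at most the
  -- parameter distance.
  have hlt : ∀ q q' : Fin N × Icc (0 : ℝ) 1, q.1 < q'.1 → ‖f q - f q'‖ ≤ δ * |τ q - τ q'| := by
    intro q q' h
    have h1 : p (q.1 + 1) ≤ p q'.1 := hmono h
    have h2 := hright q
    have h3 := hleft q'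
    have h4 : τ q' - τ q ≤ |τ q - τ q'| := by
      rw [abs_sub_comm]
      exact le_abs_self _
    have h5 := mul_le_mul_of_nonneg_left h4 hδ0.le
    have h6 := mul_le_mul_of_nonneg_left h1 hδ0.le
    linarith [norm_sub_le (f q) (f q')]
  have hflip : ∀ q q', ‖f q - f q'‖ ≤ δ * |τ q - τ q'| := by
    intro q q'
    rcases lt_trichotomy q.1 q'.1 with h | h | h
    · exact hlt q q' h
    · obtain ⟨k, r⟩ := q
      obtain ⟨k', r'⟩ := q'
      obtain rfl : k = k' := h
      exact hsame k r r'
    · rw [norm_sub_rev, abs_sub_comm]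
      exact hlt q' q h
  have hfmin : ∀ q, ‖f q‖ ≤ δ * min (τ q - a) (b - τ q) := by
    intro q
    rw [mul_min_of_nonneg _ _ hδ0.le]
    refine le_min ((hleft q).trans ?_) ((hright q).trans ?_)
    · gcongr
      exact (hpmem _ q.1.2.le).1
    · gcongr
      exact (hpmem _ q.1.2).2
  have hδm : δ < m := by
    rw [hδ, div_lt_iff₀ (by positivity)]
    nlinarith
  -- A displacement of at most `δ * d` faces a distance of at least `m * d - δ * d` between the
  -- points before displacement.
  let c : NNReal := ⟨δ / (m - δ), div_nonneg hδ0.le (by linarith)⟩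
  have hcval : (c : ℝ) = δ / (m - δ) := rfl
  have hcm : (c : ℝ) * (m - δ) = δ := by
    rw [hcval, div_mul_cancel₀]
    linarith
  have hc1 : lipschitzExtensionConstant (Euc n) * c < 1 := by
    rw [← NNReal.coe_lt_coe, NNReal.coe_mul, NNReal.coe_one, ← hK, hcval, ← mul_div_assoc,
      div_lt_one (by linarith)]
    have : δ * (2 * K + 2) = m := by
      rw [hδ]
      field_simp
    nlinarith
  -- `Γ` and the inscribed polygon, together with the points of `S`
  have hest : ∀ {x d r : ℝ}, 0 ≤ d → x ≤ δ * d → m * d ≤ r + x → x ≤ c * r := by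
    intro x d r hd h1 h2
    have h3 : (m - δ) * d ≤ r := by linarith
    have h4 := mul_le_mul_of_nonneg_left h3 c.2
    calc x ≤ δ * d := h1
      _ = c * ((m - δ) * d) := by rw [← mul_assoc, hcm]
      _ ≤ c * r := h4
  have hmix : ∀ q, ∀ x ∈ S, ‖f q‖ ≤ c * ‖Q q - x‖ := by
    intro q x hx
    refine hest (d := min (τ q - a) (b - τ q)) ?_ (hfmin q) ?_
    · exact le_min (by linarith [(hτab q).1]) (by linarith [(hτab q).2])
    · refine (hS _ (hτab q) x hx).trans ?_
      have : Γ (τ q) - x = (Q q - x) + f q := by simp only [f]; abel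
      rw [this]
      exact norm_add_le _ _
  obtain ⟨e, he, heP⟩ := exists_extendsOriented_of_lipschitz_family
    (ι := (Fin N × Icc (0 : ℝ) 1) ⊕ S) (Sum.elim Q (↑)) (Sum.elim (fun q => Γ (τ q)) (↑)) c hc1 (by
      rintro (q | x) (q' | x')
      · refine hest (x := ‖f q - f q'‖) (abs_nonneg (τ q - τ q')) (hflip q q') ?_
        refine (hlow _ (hτab q) _ (hτab q')).trans ?_
        have : Γ (τ q) - Γ (τ q') = (Q q - Q q') + (f q - f q') := by simp only [f]; abel
        rw [this]
        exact norm_add_le _ _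
      · simpa [f] using hmix q x' x'.2
      · simpa [f, norm_sub_rev] using hmix q' x x.2
      · simp only [Sum.elim_inr, sub_self, norm_zero]
        positivity)
  refine ⟨N, e, hN0, he, fun x hx => heP (Sum.inr ⟨x, hx⟩), ?_⟩
  apply Subset.antisymm
  · rintro _ ⟨x, hx, rfl⟩
    simp only [mem_iUnion] at hx
    obtain ⟨k, hk, hx⟩ := hx
    rw [segment_eq_image_lineMap] at hx
    obtain ⟨r, hr, rfl⟩ := hx
    have := heP (Sum.inl (⟨k, hk⟩, ⟨r, hr⟩))
    exact ⟨τ (⟨k, hk⟩, ⟨r, hr⟩), hτab _, this.symm⟩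
  · rintro _ ⟨t, ht, rfl⟩
    obtain ⟨k, hk, htk⟩ := exists_mem_partition hN0 ht
    rw [← segment_eq_Icc (hmono (Nat.le_succ k)), segment_eq_image_lineMap] at htk
    obtain ⟨r, hr, rfl⟩ := htk
    have := heP (Sum.inl (⟨k, hk⟩, ⟨r, hr⟩))
    refine ⟨Q (⟨k, hk⟩, ⟨r, hr⟩), ?_, this⟩
    simp only [mem_iUnion]
    refine ⟨k, hk, ?_⟩
    rw [segment_eq_image_lineMap]
    exact mem_image_of_mem _ hr

end Inscribed

/-! ### The branches of a polynomial at infinity -/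

section Branches

open Polynomial

theorem Polynomial.eval_inv_mul_pow_natDegree (p : ℝ[X]) {z : ℝ} (hz : z ≠ 0) :
    p.eval z⁻¹ * z ^ p.natDegree = p.reverse.eval z := by
  let _ : Invertible z⁻¹ := invertibleOfNonzero (inv_ne_zero hz)
  have h := eval₂_reverse_mul_pow (RingHom.id ℝ) z⁻¹ p
  rw [eval₂_id, eval₂_id, invOf_eq_inv, inv_inv] at h
  rw [← h, inv_pow, mul_assoc, inv_mul_cancel₀ (pow_ne_zero _ hz), mul_one]

open scoped ContDiff in
/-- An analytic function with nonzero derivative has an analytic local inverse. -/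
theorem exists_analyticAt_localInverse {f : ℝ → ℝ} {f' a : ℝ} (hf : AnalyticAt ℝ f a)
    (hd : HasDerivAt f f' a) (hf' : f' ≠ 0) :
    ∃ g : ℝ → ℝ, AnalyticAt ℝ g (f a) ∧ g (f a) = a ∧ ∀ᶠ y in 𝓝 (f a), f (g y) = y := by
  have hc : ContDiffAt ℝ ω f a := hf.contDiffAt
  let e : ℝ ≃L[ℝ] ℝ := ContinuousLinearEquiv.unitsEquivAut ℝ (Units.mk0 f' hf')
  have he : HasFDerivAt f (e : ℝ →L[ℝ] ℝ) a := by
    have heq : (e : ℝ →L[ℝ] ℝ) = ContinuousLinearMap.toSpanSingleton ℝ f' := by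
      ext
      simp [e]
    rw [heq]
    exact hd.hasFDerivAt
  refine ⟨hc.localInverse he (by simp), (hc.to_localInverse he (by simp)).analyticAt,
    hc.localInverse_apply_image he (by simp), ?_⟩
  exact (hc.hasStrictFDerivAt' he (by simp)).eventually_right_inverse

/-- For a polynomial `p` of even degree, the point on the left branch of `p` at infinity at which
`p` takes the same value as at a point of the right branch is an analytic function of this point,
in the coordinate `1 / t`. -/
theorem exists_analyticAt_conjugate {p : ℝ[X]} (hp : 0 < p.natDegree) (heven : Even p.natDegree) :
    ∃ ι : ℝ → ℝ, AnalyticAt ℝ ι 0 ∧ ι 0 = 0 ∧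
      ∀ᶠ z in 𝓝[>] (0 : ℝ), ι z < 0 ∧ p.eval (ι z)⁻¹ = p.eval z⁻¹ := by
  set d := p.natDegree with hd
  set a := p.leadingCoeff with ha
  have ha0 : a ≠ 0 := by
    rw [ha, Ne, leadingCoeff_eq_zero]
    rintro rfl
    simp [hd] at hp
  have hd0 : (d : ℝ) ≠ 0 := by positivity
  let Q : ℝ → ℝ := fun z => p.reverse.eval z / a
  have hQ0 : Q 0 = 1 := by
    simp only [Q, ← coeff_zero_eq_eval_zero, coeff_zero_reverse]
    exact div_self ha0
  have hQa : AnalyticAt ℝ Q 0 := by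
    have h1 : AnalyticAt ℝ (fun z : ℝ => p.reverse.eval z) 0 := by
      simpa using (analyticAt_id (𝕜 := ℝ) (z := (0 : ℝ))).aeval_polynomial p.reverse
    exact h1.div_const
  -- This is `Q ^ (-1 / d)`, analytic because `Q 0 = 1`. In the coordinate `ζ z = z * g z` the
  -- polynomial becomes the pure power `a * ζ ^ (-d)`.
  let g : ℝ → ℝ := fun z => Real.exp (-(Real.log (Q z) / d))
  have hga : AnalyticAt ℝ g 0 :=
    (((hQa.log (by rw [hQ0]; exact one_pos)).div_const).neg).rexp'
  have hg0 : g 0 = 1 := by simp [g, hQ0]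
  have hgpos : ∀ z, 0 < g z := fun z => Real.exp_pos _
  have hgpow : ∀ z, 0 < Q z → g z ^ d * Q z = 1 := by
    intro z hz
    have : g z ^ d = (Q z)⁻¹ := by
      simp only [g]
      rw [← Real.exp_nat_mul, mul_neg, mul_div_cancel₀ _ hd0, Real.exp_neg, Real.exp_log hz]
    rw [this, inv_mul_cancel₀ hz.ne']
  let ζ : ℝ → ℝ := fun z => z * g z
  have hζa : AnalyticAt ℝ ζ 0 := analyticAt_id.mul hga
  have hζ0 : ζ 0 = 0 := by simp [ζ]
  have hζd : HasDerivAt ζ 1 0 := by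
    have := (hasDerivAt_id (0 : ℝ)).mul hga.differentiableAt.hasDerivAt
    exact HasDerivAt.congr_deriv (f := ζ) this (by simp [hg0])
  obtain ⟨θ, hθa, hθ0, hθ⟩ := exists_analyticAt_localInverse hζa hζd one_ne_zero
  rw [hζ0] at hθa hθ0 hθ
  have hval : ∀ z, z ≠ 0 → 0 < Q z → p.eval z⁻¹ * ζ z ^ d = a := by
    intro z hz hQz
    have h1 := p.eval_inv_mul_pow_natDegree hz
    have h2 : p.reverse.eval z = a * Q z := by
      simp only [Q]
      field_simp
    calc p.eval z⁻¹ * ζ z ^ d = (p.eval z⁻¹ * z ^ d) * g z ^ d := by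
          simp only [ζ, mul_pow]
          ring
      _ = a * (g z ^ d * Q z) := by rw [hd, h1, h2]; ring
      _ = a := by rw [hgpow z hQz, mul_one]
  -- As `d` is even, passing to the other branch with the same value is `ζ ↦ -ζ`.
  let ι : ℝ → ℝ := fun z => θ (-ζ z)
  have hneg : -ζ 0 = 0 := by rw [hζ0, neg_zero]
  have hι0 : ι 0 = 0 := by simp only [ι, hneg, hθ0]
  have hιa : AnalyticAt ℝ ι 0 := by
    refine AnalyticAt.fun_comp (g := θ) (f := fun z => -ζ z) ?_ hζa.neg
    rwa [hneg]
  refine ⟨ι, hιa, hι0, ?_⟩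
  have hQpos : ∀ᶠ z in 𝓝 (0 : ℝ), 0 < Q z :=
    hQa.continuousAt.eventually_const_lt (by rw [hQ0]; exact one_pos)
  have hQι : ∀ᶠ z in 𝓝 (0 : ℝ), 0 < Q (ι z) := by
    have : Tendsto ι (𝓝 0) (𝓝 0) := by
      have := hιa.continuousAt.tendsto
      rwa [hι0] at this
    exact this.eventually hQpos
  have hζι : ∀ᶠ z in 𝓝 (0 : ℝ), ζ (ι z) = -ζ z := by
    have : Tendsto (fun z => -ζ z) (𝓝 0) (𝓝 0) := by
      have := hζa.continuousAt.tendsto.neg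
      rwa [hneg] at this
    exact this.eventually hθ
  filter_upwards [hQpos.filter_mono nhdsWithin_le_nhds, hQι.filter_mono nhdsWithin_le_nhds,
    hζι.filter_mono nhdsWithin_le_nhds, self_mem_nhdsWithin] with z h1 h2 h3 hz
  have hz0 : 0 < z := hz
  have hζz : 0 < ζ z := mul_pos hz0 (hgpos z)
  have hιneg : ι z < 0 := by
    have : ι z * g (ι z) < 0 := by
      change ζ (ι z) < 0
      rw [h3]
      linarith
    exact neg_of_mul_neg_left this (hgpos _).le
  refine ⟨hιneg, ?_⟩
  have e1 := hval z hz0.ne' h1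
  have e2 := hval (ι z) hιneg.ne h2
  rw [h3, heven.neg_pow, ← e1] at e2
  exact mul_right_cancel₀ (pow_ne_zero _ hζz.ne') e2

theorem meromorphicAt_polynomial_eval (q : ℝ[X]) {f : ℝ → ℝ} {x : ℝ} (hf : MeromorphicAt f x) :
    MeromorphicAt (fun z => q.eval (f z)) x := by
  induction q using Polynomial.induction_on' with
  | add p q hp hq =>
    simp only [eval_add]
    exact hp.add hq
  | monomial k c =>
    simp only [eval_monomial]
    exact (MeromorphicAt.const c x).mul (hf.pow k)

/-- If the first of finitely many polynomials has even degree and together they separate the points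
of the line, then one of them separates the two branches of the first one at infinity. -/
theorem exists_eval_ne_of_even {n : ℕ} {P : Fin n → ℝ[X]} {i : Fin n}
    (hinj : ∀ s t : ℝ, (∀ j, (P j).eval s = (P j).eval t) → s = t)
    (hp : 0 < (P i).natDegree) (heven : Even (P i).natDegree) {T₀ : ℝ}
    (hT₀ : InjOn (fun t => (P i).eval t) (Iic T₀)) :
    ∃ (j : Fin n) (T : ℝ), ∀ t ≥ T, ∀ s ≤ T₀, (P i).eval s = (P i).eval t →
      (P j).eval s ≠ (P j).eval t := by
  obtain ⟨ι, hιa, hι0, hι⟩ := exists_analyticAt_conjugate hp heven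
  have hmer : ∀ j, MeromorphicAt (fun z => (P j).eval z⁻¹ - (P j).eval (ι z)⁻¹) 0 := fun j =>
    (meromorphicAt_polynomial_eval (P j) (MeromorphicAt.id (0 : ℝ)).inv).sub
      (meromorphicAt_polynomial_eval (P j) hιa.meromorphicAt.inv)
  have hle : 𝓝[>] (0 : ℝ) ≤ 𝓝[≠] 0 := nhdsGT_le_nhdsNE 0
  -- A meromorphic function vanishes identically or nowhere on a punctured neighborhood. If all
  -- differences vanished, the curve would have double points.
  obtain ⟨j, hj⟩ : ∃ j, ∀ᶠ z in 𝓝[>] (0 : ℝ), (P j).eval z⁻¹ - (P j).eval (ι z)⁻¹ ≠ 0 := by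
    by_contra! hcon
    have h0 : ∀ j, ∀ᶠ z in 𝓝[>] (0 : ℝ), (P j).eval z⁻¹ - (P j).eval (ι z)⁻¹ = 0 := by
      intro j
      rcases (hmer j).eventually_eq_zero_or_eventually_ne_zero with h | h
      · exact h.filter_mono hle
      · exact absurd (h.filter_mono hle) (by simpa using hcon j)
    have h1 := eventually_all.2 h0
    obtain ⟨z, hz, hzι, hz0⟩ := (h1.and (hι.and self_mem_nhdsWithin)).exists
    have := hinj z⁻¹ (ι z)⁻¹ fun j => sub_eq_zero.1 (hz j)
    have h2 : z = ι z := inv_injective this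
    have h3 : (0 : ℝ) < z := hz0
    linarith [hzι.1]
  have htend : Tendsto ι (𝓝[>] 0) (𝓝[<] 0) := by
    refine tendsto_nhdsWithin_iff.2 ⟨?_, hι.mono fun z hz => hz.1⟩
    have := hιa.continuousAt.tendsto
    rw [hι0] at this
    exact this.mono_left nhdsWithin_le_nhds
  have hfar : ∀ᶠ z in 𝓝[>] (0 : ℝ), (ι z)⁻¹ ≤ T₀ :=
    (tendsto_inv_nhdsLT_zero.comp htend).eventually (eventually_le_atBot T₀)
  have hall := tendsto_inv_atTop_nhdsGT_zero.eventually (hj.and (hι.and hfar))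
  obtain ⟨T, hT⟩ := eventually_atTop.1 hall
  refine ⟨j, T, fun t ht s hs hst hcon => ?_⟩
  obtain ⟨h1, ⟨-, h2⟩, h3⟩ := hT t ht
  rw [inv_inv] at h1 h2
  -- On the left branch the value of `P i` determines the point, so `s` is the analytic conjugate of
  -- `t`.
  have : s = (ι t⁻¹)⁻¹ := hT₀ hs h3 (by simp only [hst, h2])
  rw [this] at hcon
  exact h1 (sub_eq_zero.2 hcon.symm)

end Branches

/-! ### Straightening the ends of a curve -/

section Elementary

variable {n : ℕ}

/-- Each level of the `i`-th coordinate is translated within itself, so subtracting the same vector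
inverts every stage of the isotopy. -/
theorem exists_extendsOriented_shear {i : Fin n} {b : ℝ → Euc n} (hb : Continuous b)
    (hbi : ∀ c, b c i = 0) :
    ∃ h : Euc n ≃ₜ Euc n, ExtendsOriented h ∧ ∀ x, h x = x + b (x i) := by
  obtain ⟨h, hh, hx⟩ := exists_extendsOriented_of_isotopy
    (fun q => q.2 + (q.1 : ℝ) • b (q.2 i)) (fun q => q.2 - (q.1 : ℝ) • b (q.2 i))
    (by fun_prop) (by fun_prop) (fun s x => by simp [hbi]) (fun x => by simp [hbi])
    (fun x => by simp)
  exact ⟨h, hh, fun x => by simp [hx]⟩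

/-- On each level the `j`-th coordinate undergoes an affine map with fixed point `c` and slope `1 +
d y j`. The slope stays positive when `d` is scaled by `s ∈ [0, 1]`, which keeps the isotopy
invertible. The hyperplane `x j = c` does not move. -/
theorem exists_extendsOriented_linear_shear {i j : Fin n} (c : ℝ) {d : ℝ → Euc n}
    (hd : Continuous d) (hdi : ∀ y, d y i = 0) (hdj : ∀ y, 0 < 1 + d y j) :
    ∃ h : Euc n ≃ₜ Euc n, ExtendsOriented h ∧ ∀ x, h x = x + (x j - c) • d (x i) := by
  have hpos : ∀ (s : unitInterval) (y : ℝ), 0 < 1 + (s : ℝ) * d y j := by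
    intro s y
    have h0 := s.2.1
    have h1 := s.2.2
    nlinarith [hdj y, mul_nonneg h0 (hdj y).le]
  have hne : ∀ q : unitInterval × Euc n, 1 + (q.1 : ℝ) * d (q.2 i) j ≠ 0 := fun q => (hpos _ _).ne'
  have hinv : Continuous fun q : unitInterval × Euc n => (1 + (q.1 : ℝ) * d (q.2 i) j)⁻¹ :=
    Continuous.inv₀ (by fun_prop) hne
  obtain ⟨h, hh, hx⟩ := exists_extendsOriented_of_isotopy
    (fun q => q.2 + ((q.1 : ℝ) * (q.2 j - c)) • d (q.2 i))
    (fun q => q.2 - ((q.1 : ℝ) * (q.2 j - c) * (1 + (q.1 : ℝ) * d (q.2 i) j)⁻¹) • d (q.2 i))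
    (by fun_prop) (by fun_prop)
    (fun s x => by
      have h1 := (hpos s (x i)).ne'
      simp only [PiLp.add_apply, PiLp.smul_apply, hdi, mul_zero, add_zero, smul_eq_mul]
      have : (s : ℝ) * (x j + s * (x j - c) * d (x i) j - c) * (1 + s * d (x i) j)⁻¹ =
          s * (x j - c) := by
        field_simp
        ring
      rw [this, add_sub_cancel_right])
    (fun x => by
      have h1 := (hpos 1 (x i)).ne'
      rw [Icc.coe_one, one_mul] at h1
      simp only [PiLp.sub_apply, PiLp.smul_apply, hdi, mul_zero, sub_zero, smul_eq_mul,
        Icc.coe_one, one_mul]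
      have : x j - (x j - c) * (1 + d (x i) j)⁻¹ * d (x i) j - c =
          (x j - c) * (1 + d (x i) j)⁻¹ := by
        field_simp
        ring
      rw [this, sub_add_cancel])
    (fun x => by simp)
  exact ⟨h, hh, fun x => by simp [hx]⟩

/-- Each level is scaled about the `i`-th axis, and the factors interpolated between `1` and `μ`
remain positive. -/
theorem exists_extendsOriented_stretch (i : Fin n) {μ : ℝ → ℝ} (hμ : Continuous μ)
    (hpos : ∀ y, 0 < μ y) :
    ∃ h : Euc n ≃ₜ Euc n, ExtendsOriented h ∧
      ∀ x, h x = μ (x i) • x + ((1 - μ (x i)) * x i) • EuclideanSpace.single i (1 : ℝ) := by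
  let ν : unitInterval × Euc n → ℝ := fun q => 1 + (q.1 : ℝ) * (μ (q.2 i) - 1)
  have hν : ∀ q, 0 < ν q := by
    rintro ⟨s, x⟩
    have h0 := s.2.1
    have h1 := s.2.2
    simp only [ν]
    nlinarith [hpos (x i), mul_nonneg h0 (hpos (x i)).le]
  have hνc : Continuous ν := by
    simp only [ν]
    fun_prop
  have hνi : Continuous fun q => (ν q)⁻¹ := hνc.inv₀ fun q => (hν q).ne'
  have hcoord : ∀ (a : ℝ) (x : Euc n),
      (a • x + ((1 - a) * x i) • EuclideanSpace.single i (1 : ℝ)) i = x i := by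
    intro a x
    simp
    ring
  have hcomp : ∀ (a b : ℝ) (x : Euc n), a * b = 1 →
      a • (b • x + ((1 - b) * x i) • EuclideanSpace.single i (1 : ℝ)) +
        ((1 - a) * x i) • EuclideanSpace.single i (1 : ℝ) = x := by
    intro a b x hab
    rw [smul_add, smul_smul, smul_smul, hab, one_smul, add_assoc, ← add_smul]
    have : a * ((1 - b) * x i) + (1 - a) * x i = 0 := by linear_combination (-x i) * hab
    rw [this, zero_smul, add_zero]
  obtain ⟨h, hh, hx⟩ := exists_extendsOriented_of_isotopy
    (fun q => ν q • q.2 + ((1 - ν q) * q.2 i) • EuclideanSpace.single i (1 : ℝ))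
    (fun q => (ν q)⁻¹ • q.2 + ((1 - (ν q)⁻¹) * q.2 i) • EuclideanSpace.single i (1 : ℝ))
    (by fun_prop) (by fun_prop)
    (fun s x => by
      have : ν (s, ν (s, x) • x + ((1 - ν (s, x)) * x i) • EuclideanSpace.single i (1 : ℝ)) =
          ν (s, x) := by simp only [ν, hcoord]
      simp only [this, hcoord]
      exact hcomp _ _ x (inv_mul_cancel₀ (hν _).ne'))
    (fun x => by
      have : ν (1, (ν (1, x))⁻¹ • x + ((1 - (ν (1, x))⁻¹) * x i) •
          EuclideanSpace.single i (1 : ℝ)) = ν (1, x) := by simp only [ν, hcoord]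
      simp only [this, hcoord]
      exact hcomp _ _ x (mul_inv_cancel₀ (hν _).ne'))
    (fun x => by simp [ν])
  exact ⟨h, hh, fun x => by simp [hx, ν]⟩

end Elementary

/-! ### From graphs over the height to straight half-lines and rays. -/

section Ends

variable {n : ℕ}

theorem mul_self_of_eq_one_or_neg_one {ε : ℝ} (hε : ε = 1 ∨ ε = -1) : ε * ε = 1 := by
  rcases hε with rfl | rfl <;> norm_num

theorem le_of_abs_le_of_eq_one_or_neg_one {ε c R : ℝ} (hε : ε = 1 ∨ ε = -1) (hc : |c| ≤ R) :
    ε * c ≤ R := by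
  rcases hε with rfl | rfl <;> linarith [le_abs_self c, neg_abs_le c]

/-- The deviation of a curve over the half-line `ε h`, `h ≥ R`, from a straight line. -/
noncomputable def endDeviation (i : Fin n) (x : ℝ → Euc n) (ε R c : ℝ) : Euc n :=
  -- Truncation at `R` makes the deviation vanish where `ε * c ≤ R`, so that shearing by it fixes
  -- the slab and the opposite end.
  x (max (ε * c) R) - x R - ((max (ε * c) R - R) * ε) • EuclideanSpace.single i (1 : ℝ)

theorem continuous_endDeviation (i : Fin n) {x : ℝ → Euc n} (hx : Continuous x) (ε R : ℝ) :
    Continuous (endDeviation i x ε R) := by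
  unfold endDeviation
  fun_prop

theorem endDeviation_eq_zero (i : Fin n) (x : ℝ → Euc n) {ε R c : ℝ} (h : ε * c ≤ R) :
    endDeviation i x ε R c = 0 := by
  simp [endDeviation, max_eq_right h]

theorem endDeviation_of_le (i : Fin n) (x : ℝ → Euc n) {ε R h : ℝ} (hε : ε = 1 ∨ ε = -1)
    (hR : R ≤ h) : endDeviation i x ε R (ε * h) =
      x h - x R - ((h - R) * ε) • EuclideanSpace.single i (1 : ℝ) := by
  rw [endDeviation, ← mul_assoc, mul_self_of_eq_one_or_neg_one hε, one_mul, max_eq_left hR]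

theorem endDeviation_apply_height {i : Fin n} {x : ℝ → Euc n} {ε R : ℝ}
    (hx : ∀ h ≥ R, x h i = ε * h) (c : ℝ) : endDeviation i x ε R c i = 0 := by
  simp [endDeviation, hx _ (le_max_right _ _), hx R le_rfl]
  ring

/-- A change of sign would produce a zero by the intermediate value theorem. The quotient is the
slope needed in `exists_extendsOriented_linear_shear`. -/
theorem same_sign_of_ne_zero {w : ℝ → ℝ} (hw : Continuous w) {R : ℝ} (h0 : ∀ h ≥ R, w h ≠ 0)
    {h : ℝ} (hh : R ≤ h) : 0 < w R / w h := by
  have hne := h0 h hh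
  have hR := h0 R le_rfl
  by_contra hcon
  have hprod : w R * w h ≤ 0 := by
    have h1 : w R / w h ≤ 0 := not_lt.1 hcon
    have h2 : w R * w h = w R / w h * w h ^ 2 := by field_simp
    rw [h2]
    exact mul_nonpos_of_nonpos_of_nonneg h1 (sq_nonneg _)
  have hzero : (0 : ℝ) ∈ uIcc (w R) (w h) := by
    rw [mem_uIcc]
    rcases lt_or_gt_of_ne hR with hlt | hgt
    · exact Or.inl ⟨hlt.le, by nlinarith⟩
    · exact Or.inr ⟨by nlinarith, hgt.le⟩
  obtain ⟨y, hy, hy0⟩ := intermediate_value_uIcc hw.continuousOn hzero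
  rw [uIcc_of_le hh] at hy
  exact h0 y hy.1 hy0

/-- Two curves that are parametrized by their height, in opposite directions or separated by a
coordinate, are straightened by a homeomorphism that fixes a slab. -/
theorem exists_extendsOriented_straighten {i : Fin n} {R : ℝ} {x y : ℝ → Euc n}
    (hxc : Continuous x) (hyc : Continuous y) {ε δ : ℝ} (hε : ε = 1 ∨ ε = -1)
    (hδ : δ = 1 ∨ δ = -1) (hx : ∀ h ≥ R, x h i = ε * h) (hy : ∀ h ≥ R, y h i = δ * h) (hR : 0 < R)
    (hcase : ε = -δ ∨ (ε = δ ∧ ∃ j, ∀ h ≥ R, x h j ≠ y h j)) :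
    ∃ H : Euc n ≃ₜ Euc n, ExtendsOriented H ∧ (∀ z, |z i| ≤ R → H z = z) ∧
      (∀ h ≥ R, H (x h) = x R + ((h - R) * ε) • EuclideanSpace.single i (1 : ℝ)) ∧
      (∀ h ≥ R, H (y h) = y R + ((h - R) * δ) • EuclideanSpace.single i (1 : ℝ)) := by
  obtain ⟨H₁, hH₁, hH₁z⟩ := exists_extendsOriented_shear
    (b := fun c => -endDeviation i y δ R c) (continuous_endDeviation i hyc δ R).neg
    (fun c => by rw [PiLp.neg_apply, endDeviation_apply_height hy, neg_zero])
  have hslab₁ : ∀ z, δ * z i ≤ R → H₁ z = z := fun z hz => by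
    rw [hH₁z, endDeviation_eq_zero i y hz, neg_zero, add_zero]
  have hy₁ : ∀ h ≥ R, H₁ (y h) = y R + ((h - R) * δ) • EuclideanSpace.single i (1 : ℝ) := by
    intro h hh
    rw [hH₁z, hy h hh, endDeviation_of_le i y hδ hh]
    abel
  have hheight : ∀ h ≥ R, (y R + ((h - R) * δ) • EuclideanSpace.single i (1 : ℝ)) i = δ * h := by
    intro h hh
    simp [hy R le_rfl]
    ring
  rcases hcase with hopp | ⟨rfl, j, hj⟩
  · have hoppR : ∀ h ≥ R, δ * (ε * h) ≤ R := by
      intro h hh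
      rw [hopp, neg_mul, mul_neg, ← mul_assoc, mul_self_of_eq_one_or_neg_one hδ]
      linarith
    have hoppR' : ∀ h ≥ R, ε * (δ * h) ≤ R := by
      intro h hh
      rw [hopp, neg_mul, ← mul_assoc, mul_self_of_eq_one_or_neg_one hδ]
      linarith
    obtain ⟨H₂, hH₂, hH₂z⟩ := exists_extendsOriented_shear
      (b := fun c => -endDeviation i x ε R c) (continuous_endDeviation i hxc ε R).neg
      (fun c => by rw [PiLp.neg_apply, endDeviation_apply_height hx, neg_zero])
    have hslab₂ : ∀ z, ε * z i ≤ R → H₂ z = z := fun z hz => by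
      rw [hH₂z, endDeviation_eq_zero i x hz, neg_zero, add_zero]
    refine ⟨H₁.trans H₂, hH₁.trans hH₂, fun z hz => ?_, fun h hh => ?_, fun h hh => ?_⟩
    · rw [Homeomorph.trans_apply, hslab₁ z (le_of_abs_le_of_eq_one_or_neg_one hδ hz),
        hslab₂ z (le_of_abs_le_of_eq_one_or_neg_one hε hz)]
    · rw [Homeomorph.trans_apply, hslab₁ _ (by rw [hx h hh]; exact hoppR h hh), hH₂z, hx h hh,
        endDeviation_of_le i x hε hh]
      abel
    · rw [Homeomorph.trans_apply, hy₁ h hh, hslab₂]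
      rw [hheight h hh]
      exact hoppR' h hh
  · let w : ℝ → Euc n := fun h => x h - y h
    have hwc : Continuous w := hxc.sub hyc
    have hwj : ∀ h ≥ R, w h j ≠ 0 := fun h hh => by
      simp only [w, PiLp.sub_apply]
      exact sub_ne_zero.2 (hj h hh)
    have hwi : ∀ h ≥ R, w h i = 0 := fun h hh => by
      simp [w, hx h hh, hy h hh]
    -- After `H₁` the second end is vertical and the first one is that line plus `w h`. Multiplied
    -- by the offset `w h j`, `d` replaces `w h` by `w R`; the second end has offset `0` and stays
    -- put.
    let d : ℝ → Euc n := fun c => (w (max (ε * c) R) j)⁻¹ • (w R - w (max (ε * c) R))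
    have hdc : Continuous d := by
      have h1 : Continuous fun c => (w (max (ε * c) R) j)⁻¹ :=
        Continuous.inv₀ (by fun_prop) fun c => hwj _ (le_max_right _ _)
      fun_prop
    obtain ⟨H₂, hH₂, hH₂z⟩ := exists_extendsOriented_linear_shear (i := i) (j := j) (y R j) hdc
      (fun c => by simp [d, hwi R le_rfl, hwi _ (le_max_right (ε * c) R)])
      (fun c => by
        have h1 := hwj _ (le_max_right (ε * c) R)
        have h2 : 1 + d c j = w R j / w (max (ε * c) R) j := by
          simp only [d, PiLp.smul_apply, PiLp.sub_apply, smul_eq_mul]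
          field_simp
          ring
        rw [h2]
        exact same_sign_of_ne_zero (w := fun h => w h j) (by fun_prop) hwj (le_max_right _ _))
    have hdR : ∀ c, ε * c ≤ R → d c = 0 := fun c hc => by simp [d, max_eq_right hc]
    have hdh : ∀ h ≥ R, d (ε * h) = (w h j)⁻¹ • (w R - w h) := fun h hh => by
      simp only [d]
      rw [← mul_assoc, mul_self_of_eq_one_or_neg_one hε, one_mul, max_eq_left hh]
    have hji : j ≠ i := by
      rintro rfl
      exact hwj R le_rfl (hwi R le_rfl)
    refine ⟨H₁.trans H₂, hH₁.trans hH₂, fun z hz => ?_, fun h hh => ?_, fun h hh => ?_⟩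
    · have hz' := le_of_abs_le_of_eq_one_or_neg_one hε hz
      rw [Homeomorph.trans_apply, hslab₁ z hz', hH₂z, hdR _ hz', smul_zero, add_zero]
    · have h1 : H₁ (x h) = y R + w h + ((h - R) * ε) • EuclideanSpace.single i (1 : ℝ) := by
        rw [hH₁z, hx h hh, endDeviation_of_le i y hε hh]
        simp only [w]
        abel
      have h2 : (H₁ (x h)) i = ε * h := by
        rw [h1, ← hheight h hh]
        simp [hwi h hh]
      have h3 : (H₁ (x h)) j - y R j = w h j := by
        rw [h1]
        simp [hji]
      rw [Homeomorph.trans_apply, hH₂z, h2, h3, hdh h hh, smul_smul,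
        mul_inv_cancel₀ (hwj h hh), one_smul, h1]
      simp only [w]
      abel
    · rw [Homeomorph.trans_apply, hy₁ h hh, hH₂z]
      have : (y R + ((h - R) * ε) • EuclideanSpace.single i (1 : ℝ)) j - y R j = 0 := by
        simp [hji]
      rw [this, zero_smul, add_zero]

/-- Two curves that are parametrized by their height, in opposite directions or separated by a
coordinate, are taken to rays by a homeomorphism that is a translation on a slab. -/
theorem exists_extendsOriented_radial {i : Fin n} {R : ℝ} {x y : ℝ → Euc n}
    (hxc : Continuous x) (hyc : Continuous y) {ε δ : ℝ} (hε : ε = 1 ∨ ε = -1)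
    (hδ : δ = 1 ∨ δ = -1) (hx : ∀ h ≥ R, x h i = ε * h) (hy : ∀ h ≥ R, y h i = δ * h) (hR : 0 < R)
    (hcase : ε = -δ ∨ (ε = δ ∧ ∃ j, ∀ h ≥ R, x h j ≠ y h j)) {q : Euc n} (hq : q i = 0) :
    ∃ H : Euc n ≃ₜ Euc n, ExtendsOriented H ∧ (∀ z, |z i| ≤ R → H z = z - q) ∧
      (∀ h ≥ R, H (x h) = (h / R) • (x R - q)) ∧ (∀ h ≥ R, H (y h) = (h / R) • (y R - q)) := by
  obtain ⟨H₁, hH₁, hslab, hx₁, hy₁⟩ :=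
    exists_extendsOriented_straighten hxc hyc hε hδ hx hy hR hcase
  obtain ⟨H₂, hH₂, hH₂z⟩ := exists_extendsOriented_shear (i := i) (b := fun _ => -q)
    continuous_const (fun _ => by simp [hq])
  -- Scaling the level `c` horizontally by `|c| / R` outside the slab tilts a vertical half-line
  -- into the ray from `0` through its starting point.
  obtain ⟨H₃, hH₃, hH₃z⟩ := exists_extendsOriented_stretch i (μ := fun c => max (|c| / R) 1)
    (by fun_prop) (fun c => lt_max_of_lt_right one_pos)
  have hray : ∀ (ε h : ℝ) (a : Euc n), (ε = 1 ∨ ε = -1) → a i = ε * R → R ≤ h →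
      H₃ (H₂ (a + ((h - R) * ε) • EuclideanSpace.single i (1 : ℝ))) = (h / R) • (a - q) := by
    intro ε h a hε ha hh
    have hi : (a + ((h - R) * ε) • EuclideanSpace.single i (1 : ℝ) + -q) i = ε * h := by
      simp [ha, hq]
      ring
    have hμ : max (|ε * h| / R) 1 = h / R := by
      have : |ε * h| = h := by
        have h0 : |h| = h := abs_of_nonneg (hR.le.trans hh)
        rcases hε with rfl | rfl <;> simp [h0]
      rw [this, max_eq_left]
      rwa [one_le_div hR]
    rw [hH₂z, hH₃z, hi, hμ]
    have hs : (h / R) * ((h - R) * ε) + (1 - h / R) * (ε * h) = 0 := by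
      field_simp
      ring
    calc _ = (h / R) • (a - q) + ((h / R) * ((h - R) * ε) + (1 - h / R) * (ε * h)) •
          EuclideanSpace.single i (1 : ℝ) := by module
      _ = _ := by rw [hs, zero_smul, add_zero]
  refine ⟨(H₁.trans H₂).trans H₃, (hH₁.trans hH₂).trans hH₃, fun z hz => ?_, fun h hh => ?_,
    fun h hh => ?_⟩
  · have hi : (z + -q) i = z i := by simp [hq]
    have hμ : max (|z i| / R) 1 = 1 := max_eq_right ((div_le_one hR).2 hz)
    rw [Homeomorph.trans_apply, Homeomorph.trans_apply, hslab z hz, hH₂z, hH₃z, hi, hμ]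
    simp [sub_eq_add_neg]
  · rw [Homeomorph.trans_apply, Homeomorph.trans_apply, hx₁ h hh]
    exact hray ε h _ hε (hx R le_rfl) hh
  · rw [Homeomorph.trans_apply, Homeomorph.trans_apply, hy₁ h hh]
    exact hray δ h _ hδ (hy R le_rfl) hh

end Ends

/-! ### The ends of a polynomial knot -/

section PolynomialEnds

open Polynomial

/-- The derivative has positive leading coefficient, so far out it exceeds a positive constant, and
the mean value inequality applies. -/
theorem Polynomial.exists_mul_sub_le_eval_sub {p : ℝ[X]} (hp : 0 < p.natDegree)
    (hlc : 0 < p.leadingCoeff) :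
    ∃ T m : ℝ, 0 < m ∧ ∀ s ≥ T, ∀ t ≥ s, m * (t - s) ≤ p.eval t - p.eval s := by
  have hlead : 0 < p.derivative.leadingCoeff := by
    rw [leadingCoeff, natDegree_derivative, coeff_derivative, Nat.sub_add_cancel hp]
    exact mul_pos hlc (by positivity)
  obtain ⟨T, m, hm, hT⟩ : ∃ T m : ℝ, 0 < m ∧ ∀ t ≥ T, m ≤ p.derivative.eval t := by
    rcases Nat.eq_zero_or_pos p.derivative.natDegree with h0 | h0
    · refine ⟨0, p.derivative.leadingCoeff, hlead, fun t _ => ?_⟩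
      rw [eq_C_of_natDegree_eq_zero h0, eval_C, leadingCoeff_C]
    · obtain ⟨T, hT⟩ := eventually_atTop.1 ((tendsto_atTop_of_leadingCoeff_nonneg _
        (natDegree_pos_iff_degree_pos.1 h0) hlead.le).eventually_ge_atTop 1)
      exact ⟨T, 1, one_pos, hT⟩
  refine ⟨T, m, hm, fun s hs t ht => ?_⟩
  refine (convex_Ici T).mul_sub_le_image_sub_of_le_deriv p.continuousOn
    p.differentiable.differentiableOn (fun x hx => ?_) s hs t (hs.le.trans ht) ht
  rw [Polynomial.deriv]
  rw [interior_Ici] at hx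
  exact hT x (mem_Ioi.1 hx).le

/-- A continuous function that grows at least linearly on a half-line has a continuous inverse
there. -/
theorem exists_continuous_inverse_on_Ici {f : ℝ → ℝ} (hf : Continuous f) {T m : ℝ} (hm : 0 < m)
    (hmono : ∀ s ≥ T, ∀ t ≥ s, m * (t - s) ≤ f t - f s) :
    ∃ τ : ℝ → ℝ, Continuous τ ∧ (∀ h ≥ f T, T ≤ τ h ∧ f (τ h) = h) ∧ ∀ t ≥ T, τ (f t) = t := by
  -- Left of `T` the function is continued with slope `m`; the result is an increasing bijection of
  -- the line.
  let g : ℝ → ℝ := fun t => f (max t T) + m * min (t - T) 0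
  have hgc : Continuous g := by
    simp only [g]
    fun_prop
  have hg : ∀ s t, s ≤ t → m * (t - s) ≤ g t - g s := by
    intro s t hst
    have h1 := hmono (max s T) (le_max_right _ _) (max t T) (max_le_max_right T hst)
    have h2 : ∀ u : ℝ, max u T + min (u - T) 0 = u := by
      intro u
      rcases le_total u T with h | h
      · rw [max_eq_right h, min_eq_left (by linarith)]
        ring
      · rw [max_eq_left h, min_eq_right (by linarith)]
        ring
    have hs := h2 s
    have ht := h2 t
    simp only [g]
    have : m * (t - s) = m * (max t T - max s T) + (m * min (t - T) 0 - m * min (s - T) 0) := by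
      linear_combination (-m) * ht + m * hs
    linarith
  have hgm : StrictMono g := by
    intro s t hst
    have := hg s t hst.le
    have := mul_pos hm (sub_pos.2 hst)
    linarith
  have hgT : ∀ t ≥ T, g t = f t := by
    intro t ht
    simp only [g]
    rw [max_eq_left ht, min_eq_right (by linarith)]
    ring
  have htop : Tendsto g atTop atTop := by
    refine tendsto_atTop_mono' atTop (f₁ := fun t => m * t + (g 0)) ?_ ?_
    · filter_upwards [eventually_ge_atTop 0] with t ht
      linarith [hg 0 t ht]
    · exact tendsto_atTop_add_const_right _ _ (tendsto_id.const_mul_atTop hm)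
  have hbot : Tendsto g atBot atBot := by
    refine tendsto_atBot_mono' atBot (f₁ := fun t => m * t + (g 0)) ?_ ?_
    · filter_upwards [eventually_le_atBot 0] with t ht
      linarith [hg t 0 ht]
    · exact tendsto_atBot_add_const_right _ _ (tendsto_id.const_mul_atBot hm)
  let e := hgm.orderIsoOfSurjective g (hgc.surjective htop hbot)
  have he : ∀ t, e t = g t := fun t => rfl
  refine ⟨e.symm, e.symm.continuous, fun h hh => ?_, fun t ht => ?_⟩
  · have h1 : T ≤ e.symm h := by
      rw [e.le_symm_apply, he, hgT T le_rfl]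
      exact hh
    refine ⟨h1, ?_⟩
    rw [← hgT _ h1, ← he, e.apply_symm_apply]
  · rw [← hgT t ht, ← he, e.symm_apply_apply]

theorem exists_sign {a : ℝ} (ha : a ≠ 0) : ∃ ε : ℝ, (ε = 1 ∨ ε = -1) ∧ 0 < ε * a := by
  rcases lt_or_gt_of_ne ha with h | h
  · exact ⟨-1, Or.inr rfl, by linarith⟩
  · exact ⟨1, Or.inl rfl, by linarith⟩

variable {n : ℕ} {κ : ℝ → Euc n}

theorem IsPolynomialKnot.contDiff (hκ : IsPolynomialKnot κ) : ContDiff ℝ 1 κ := by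
  obtain ⟨P, hP⟩ := hκ.polynomial
  rw [contDiff_euclidean]
  intro i
  simp_rw [hP]
  simpa using (P i).contDiff_aeval (𝕜 := ℝ) 1

/-- A homeomorphism that is a translation near a compact part of a polynomial knot takes the ends
of the knot to rays with the same origin. -/
theorem IsPolynomialKnot.exists_radial_ends (hn : 2 ≤ n) (hκ : IsPolynomialKnot κ) :
    ∃ (H : Euc n ≃ₜ Euc n) (q : Euc n) (A B m : ℝ), ExtendsOriented H ∧ A ≤ B ∧ 0 < m ∧
      (∀ t ∈ Icc A B, κ t - q ≠ 0) ∧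
      H '' range κ = (fun t => κ t - q) '' Icc A B ∪
        ((fun r : ℝ => r • (κ A - q)) '' Ici 1 ∪ (fun r : ℝ => r • (κ B - q)) '' Ici 1) ∧
      ∀ t ∈ Icc A B, ∀ r ≥ (1 : ℝ), m * min (t - A) (B - t) ≤ ‖κ t - q - r • (κ A - q)‖ ∧
        m * min (t - A) (B - t) ≤ ‖κ t - q - r • (κ B - q)‖ := by
  obtain ⟨P, hP⟩ := hκ.polynomial
  have hκc : Continuous κ := hκ.contDiff.continuous
  have hsep : ∀ s t : ℝ, (∀ j, (P j).eval s = (P j).eval t) → s = t := by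
    intro s t h
    refine hκ.injective (PiLp.ext fun j => ?_)
    rw [hP, hP, h]
  obtain ⟨i, hi⟩ : ∃ i, 0 < (P i).natDegree := by
    by_contra! hcon
    refine zero_ne_one (hsep 0 1 fun j => ?_)
    rw [eq_C_of_natDegree_eq_zero (Nat.le_zero.1 (hcon j))]
    simp
  set p := P i with hp
  have hlc : p.leadingCoeff ≠ 0 := by
    rw [Ne, leadingCoeff_eq_zero]
    rintro h
    rw [h, natDegree_zero] at hi
    exact lt_irrefl _ hi
  -- the signs of the heights of the two ends
  obtain ⟨ε, hε, hεlc⟩ := exists_sign hlc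
  obtain ⟨δ, hδ, hδlc⟩ := exists_sign (mul_ne_zero (pow_ne_zero p.natDegree
    (by norm_num : (-1 : ℝ) ≠ 0)) hlc)
  have hε0 : ε ≠ 0 := by rcases hε with rfl | rfl <;> norm_num
  have hδ0 : δ ≠ 0 := by rcases hδ with rfl | rfl <;> norm_num
  obtain ⟨Tp, mp, hmp, hTp⟩ := Polynomial.exists_mul_sub_le_eval_sub (p := C ε * p)
    (by rwa [natDegree_C_mul hε0]) (by rwa [leadingCoeff_mul, leadingCoeff_C])
  have hneg : (-X : ℝ[X]).natDegree = 1 := by rw [natDegree_neg, natDegree_X]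
  obtain ⟨Tm, mm, hmm, hTm⟩ := Polynomial.exists_mul_sub_le_eval_sub
    (p := C δ * p.comp (-X))
    (by rw [natDegree_C_mul hδ0, natDegree_comp, hneg, mul_one]; exact hi)
    (by
      rw [leadingCoeff_mul, leadingCoeff_C, leadingCoeff_comp (by rw [hneg]; norm_num),
        leadingCoeff_neg, leadingCoeff_X, mul_comm p.leadingCoeff]
      exact hδlc)
  simp only [eval_mul, eval_C, eval_comp, eval_neg, eval_X] at hTp hTm
  set T₀ : ℝ := max (max Tp Tm) 0 with hT₀
  have hT₀0 : 0 ≤ T₀ := le_max_right _ _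
  set m₀ : ℝ := min mp mm with hm₀
  have hm₀0 : 0 < m₀ := lt_min hmp hmm
  have hfp : ∀ s ≥ T₀, ∀ t ≥ s, m₀ * (t - s) ≤ ε * p.eval t - ε * p.eval s := by
    intro s hs t ht
    refine le_trans ?_ (hTp s (((le_max_left Tp Tm).trans (le_max_left _ _)).trans hs) t ht)
    exact mul_le_mul_of_nonneg_right (min_le_left _ _) (sub_nonneg.2 ht)
  have hfm : ∀ s ≥ T₀, ∀ t ≥ s, m₀ * (t - s) ≤ δ * p.eval (-t) - δ * p.eval (-s) := by
    intro s hs t ht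
    refine le_trans ?_ (hTm s (((le_max_right Tp Tm).trans (le_max_left _ _)).trans hs) t ht)
    exact mul_le_mul_of_nonneg_right (min_le_right _ _) (sub_nonneg.2 ht)
  obtain ⟨τp, hτpc, hτp, hτp'⟩ := exists_continuous_inverse_on_Ici
    (f := fun t => ε * p.eval t) (by fun_prop) hm₀0 hfp
  obtain ⟨τm, hτmc, hτm, hτm'⟩ := exists_continuous_inverse_on_Ici
    (f := fun t => δ * p.eval (-t)) (by fun_prop) hm₀0 hfm
  -- the height beyond which the ends begin
  obtain ⟨M, hM⟩ : ∃ M, ∀ t ∈ Icc (-T₀) T₀, |p.eval t| ≤ M := by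
    obtain ⟨M, hM⟩ := isCompact_Icc.exists_bound_of_continuousOn (s := Icc (-T₀) T₀)
      (f := fun t => p.eval t) p.continuousOn
    exact ⟨M, hM⟩
  have hM0 : 0 ≤ M := (abs_nonneg _).trans (hM T₀ ⟨by linarith, le_rfl⟩)
  -- The `1` leaves a margin above the core `[-T₀, T₀]`. For even degree `R` is also large enough
  -- for the separating coordinate to work.
  obtain ⟨R, hRM, hcase⟩ : ∃ R, M + 1 ≤ R ∧ (ε = -δ ∨ (ε = δ ∧ ∃ j, ∀ h ≥ R,
      κ (τp h) j ≠ κ (-τm h) j)) := by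
    rcases Nat.even_or_odd p.natDegree with heven | hodd
    · have hεδ : ε = δ := by
        rw [heven.neg_one_pow, one_mul] at hδlc
        rcases hε with rfl | rfl <;> rcases hδ with rfl | rfl <;> first | rfl | linarith
      have hinj : InjOn (fun t => p.eval t) (Iic (-T₀)) := by
        intro s hs t ht hst
        rw [mem_Iic] at hs ht
        dsimp only at hst
        have h1 := hτm' (-s) (by linarith)
        have h2 := hτm' (-t) (by linarith)
        simp only [neg_neg, hst] at h1 h2
        linarith
      obtain ⟨j, T, hj⟩ := exists_eval_ne_of_even hsep hi heven hinj
      refine ⟨max (M + 1) (ε * p.eval (max T T₀)), le_max_left _ _, Or.inr ⟨hεδ, j, ?_⟩⟩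
      intro h hh
      have hMh : M + 1 ≤ h := (le_max_left _ _).trans hh
      have h1 := hτp h (by
        have := le_of_abs_le_of_eq_one_or_neg_one hε (hM T₀ ⟨by linarith, le_rfl⟩)
        linarith)
      have h2 := hτm h (by
        have := le_of_abs_le_of_eq_one_or_neg_one hδ (hM (-T₀) ⟨le_rfl, by linarith⟩)
        linarith)
      have h3 : T ≤ τp h := by
        by_contra hlt
        rw [not_le] at hlt
        have h4 := hfp (τp h) h1.1 (max T T₀) (hlt.le.trans (le_max_left _ _))
        have h5 : ε * p.eval (max T T₀) ≤ h := (le_max_right _ _).trans hh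
        have h6 : 0 < m₀ * (max T T₀ - τp h) :=
          mul_pos hm₀0 (by linarith [le_max_left T T₀])
        linarith [h1.2]
      rw [hP, hP]
      refine (hj (τp h) h3 (-τm h) (by linarith [h2.1]) ?_).symm
      have h4 : ε * p.eval (-τm h) = ε * p.eval (τp h) := by
        rw [h1.2]
        rw [← hεδ] at h2
        exact h2.2
      exact mul_left_cancel₀ hε0 h4
    · refine ⟨M + 1, le_rfl, Or.inl ?_⟩
      rw [hodd.neg_one_pow] at hδlc
      rcases hε with rfl | rfl <;> rcases hδ with rfl | rfl <;> linarith
  have hR0 : 0 < R := by linarith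
  have hgep : ∀ h ≥ R, ε * p.eval T₀ ≤ h := fun h hh => by
    have := le_of_abs_le_of_eq_one_or_neg_one hε (hM T₀ ⟨by linarith, le_rfl⟩)
    linarith
  have hgem : ∀ h ≥ R, δ * p.eval (-T₀) ≤ h := fun h hh => by
    have := le_of_abs_le_of_eq_one_or_neg_one hδ (hM (-T₀) ⟨le_rfl, by linarith⟩)
    linarith
  have hxp : ∀ h ≥ R, κ (τp h) i = ε * h := by
    intro h hh
    have h1 := (hτp h (hgep h hh)).2
    rw [hP, ← hp]
    nth_rewrite 2 [← h1]
    rw [← mul_assoc, mul_self_of_eq_one_or_neg_one hε, one_mul]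
  have hxm : ∀ h ≥ R, κ (-τm h) i = δ * h := by
    intro h hh
    have h1 := (hτm h (hgem h hh)).2
    rw [hP, ← hp]
    nth_rewrite 2 [← h1]
    rw [← mul_assoc, mul_self_of_eq_one_or_neg_one hδ, one_mul]
  set B : ℝ := τp R with hB
  set A : ℝ := -τm R with hA
  have hBT : T₀ ≤ B := (hτp R (hgep R le_rfl)).1
  have hAT : A ≤ -T₀ := by
    have := (hτm R (hgem R le_rfl)).1
    linarith
  have hAB : A ≤ B := by linarith
  have hBR : ε * p.eval B = R := (hτp R (hgep R le_rfl)).2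
  have hAR : δ * p.eval A = R := (hτm R (hgem R le_rfl)).2
  have habs : ∀ {σ c : ℝ}, (σ = 1 ∨ σ = -1) → |σ * c| = |c| := by
    intro σ c hσ
    rcases hσ with rfl | rfl <;> simp
  -- On the core the margin is `1`; beyond it the height approaches `R` in absolute value at rate at
  -- least `m₀`. This is the transversality that inscribing a polygon requires at the end points.
  have hmargin : ∀ t ∈ Icc A B, min 1 (m₀ * min (t - A) (B - t)) ≤ R - |p.eval t| := by
    intro t ht
    rcases le_total t T₀ with h1 | h1
    · rcases le_total (-T₀) t with h2 | h2
      · refine (min_le_left _ _).trans ?_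
        linarith [hM t ⟨h2, h1⟩]
      · have h3 := hfm (-t) (by linarith) (-A) (by linarith [ht.1])
        have h4 := hfm T₀ le_rfl (-t) (by linarith)
        have h5 := mul_nonneg hm₀0.le (by linarith : (0 : ℝ) ≤ -t - T₀)
        have h6 := hM (-T₀) ⟨le_rfl, by linarith⟩
        rw [← habs hδ] at h6
        rw [neg_neg, neg_neg, hAR] at h3
        rw [neg_neg] at h4
        have h7 : m₀ * min (t - A) (B - t) ≤ m₀ * (t - A) :=
          mul_le_mul_of_nonneg_left (min_le_left _ _) hm₀0.le
        rw [← habs hδ]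
        rcases abs_cases (δ * p.eval t) with ⟨h8, -⟩ | ⟨h8, -⟩
        · refine (min_le_right _ _).trans ?_
          rw [h8]
          linarith
        · refine (min_le_left _ _).trans ?_
          rw [h8]
          linarith [neg_abs_le (δ * p.eval (-T₀))]
    · have h3 := hfp t h1 B ht.2
      have h4 := hfp T₀ le_rfl t h1
      have h5 := mul_nonneg hm₀0.le (by linarith : (0 : ℝ) ≤ t - T₀)
      have h6 := hM T₀ ⟨by linarith, le_rfl⟩
      rw [← habs hε] at h6
      rw [hBR] at h3
      have h7 : m₀ * min (t - A) (B - t) ≤ m₀ * (B - t) :=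
        mul_le_mul_of_nonneg_left (min_le_right _ _) hm₀0.le
      rw [← habs hε]
      rcases abs_cases (ε * p.eval t) with ⟨h8, -⟩ | ⟨h8, -⟩
      · refine (min_le_right _ _).trans ?_
        rw [h8]
        linarith
      · refine (min_le_left _ _).trans ?_
        rw [h8]
        linarith [neg_abs_le (ε * p.eval T₀)]
  have hmin0 : ∀ t ∈ Icc A B, 0 ≤ min (t - A) (B - t) := fun t ht =>
    le_min (sub_nonneg.2 ht.1) (sub_nonneg.2 ht.2)
  set m : ℝ := min m₀ (1 / (B - A + 1)) with hm
  have hBA : 0 < B - A + 1 := by linarith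
  have hm0 : 0 < m := lt_min hm₀0 (by positivity)
  have hmargin' : ∀ t ∈ Icc A B, m * min (t - A) (B - t) ≤ R - |p.eval t| := by
    intro t ht
    refine le_trans (le_min ?_ ?_) (hmargin t ht)
    · have h1 : min (t - A) (B - t) ≤ B - A + 1 := (min_le_left _ _).trans (by linarith [ht.2])
      calc m * min (t - A) (B - t) ≤ 1 / (B - A + 1) * (B - A + 1) :=
            mul_le_mul (min_le_right _ _) h1 (hmin0 t ht) (by positivity)
        _ = 1 := by field_simp
    · exact mul_le_mul_of_nonneg_right (min_le_left _ _) (hmin0 t ht)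
  have hslab : ∀ t ∈ Icc A B, |κ t i| ≤ R := by
    intro t ht
    rw [hP]
    have := hmargin' t ht
    have := mul_nonneg hm0.le (hmin0 t ht)
    linarith
  -- the common origin of the rays
  obtain ⟨q, hqi, hq⟩ : ∃ q : Euc n, q i = 0 ∧ ∀ t ∈ Icc A B, κ t - q ≠ 0 := by
    obtain ⟨c, hc⟩ := isCompact_Icc.exists_bound_of_continuousOn (s := Icc A B) hκc.continuousOn
    have : Nontrivial (Fin n) := Fin.nontrivial_iff_two_le.2 hn
    obtain ⟨j, hj⟩ := exists_ne i
    -- The origin has height `0` and must avoid the compact arc, so it is moved far out along a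
    -- second axis; here `2 ≤ n` is needed.
    refine ⟨EuclideanSpace.single j (|c| + 1), by simp [hj.symm], fun t ht h => ?_⟩
    have h1 := hc t ht
    rw [sub_eq_zero.1 h] at h1
    rw [PiLp.norm_single, Real.norm_of_nonneg (by positivity)] at h1
    linarith [le_abs_self c]
  obtain ⟨H, hH, hHslab, hHp, hHm⟩ := exists_extendsOriented_radial
    (x := fun h => κ (τp h)) (y := fun h => κ (-τm h)) (hκc.comp hτpc)
    (hκc.comp hτmc.neg) hε hδ hxp hxm hR0 hcase hqi
  refine ⟨H, q, A, B, m, hH, hAB, hm0, hq, ?_, ?_⟩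
  · apply Subset.antisymm
    · rintro _ ⟨_, ⟨t, rfl⟩, rfl⟩
      rcases le_total t A with h1 | h1
      · right
        left
        have h2 := hτm' (-t) (by linarith)
        have h3 := hfm (-A) (by linarith) (-t) (by linarith)
        have h4 := mul_nonneg hm₀0.le (by linarith : (0 : ℝ) ≤ -t - -A)
        simp only [neg_neg] at h2 h3
        have h5 := hHm (δ * p.eval t) (by linarith)
        simp only [h2, neg_neg] at h5
        refine ⟨δ * p.eval t / R, ?_, h5.symm⟩
        rw [mem_Ici, one_le_div hR0]
        linarith
      rcases le_total t B with h2 | h2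
      · left
        exact ⟨t, ⟨h1, h2⟩, (hHslab _ (hslab t ⟨h1, h2⟩)).symm⟩
      · right
        right
        have h2' := hτp' t (by linarith)
        have h3 := hfp B hBT t h2
        have h4 := mul_nonneg hm₀0.le (by linarith : (0 : ℝ) ≤ t - B)
        have h5 := hHp (ε * p.eval t) (by linarith)
        simp only [h2'] at h5
        refine ⟨ε * p.eval t / R, ?_, h5.symm⟩
        rw [mem_Ici, one_le_div hR0]
        linarith
    · rintro _ (⟨t, ht, rfl⟩ | ⟨r, hr, rfl⟩ | ⟨r, hr, rfl⟩)
      · exact ⟨κ t, mem_range_self t, hHslab _ (hslab t ht)⟩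
      · have h1 := hHm (r * R) (le_mul_of_one_le_left hR0.le hr)
        rw [mul_div_cancel_right₀ r hR0.ne'] at h1
        exact ⟨_, mem_range_self _, h1⟩
      · have h1 := hHp (r * R) (le_mul_of_one_le_left hR0.le hr)
        rw [mul_div_cancel_right₀ r hR0.ne'] at h1
        exact ⟨_, mem_range_self _, h1⟩
  -- Comparing heights suffices: the rays lie at absolute height `r * R ≥ R`, the arc below `R` by
  -- its margin.
  · have hend : ∀ t ∈ Icc A B, ∀ u r : ℝ, |κ u i| = R → 1 ≤ r →
        m * min (t - A) (B - t) ≤ ‖κ t - q - r • (κ u - q)‖ := by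
      intro t ht u r hu hr
      refine (hmargin' t ht).trans ?_
      have h1 : |(κ t - q - r • (κ u - q)) i| ≤ ‖κ t - q - r • (κ u - q)‖ := by
        rw [← Real.norm_eq_abs]
        exact PiLp.norm_apply_le _ i
      refine le_trans ?_ h1
      have h2 : (κ t - q - r • (κ u - q)) i = p.eval t - r * κ u i := by
        simp [hqi, hP t i, hp]
      rw [h2, abs_sub_comm]
      refine le_trans ?_ (abs_sub_abs_le_abs_sub _ _)
      rw [abs_mul, hu, abs_of_nonneg (by linarith : (0 : ℝ) ≤ r)]
      have : R ≤ r * R := le_mul_of_one_le_left hR0.le hr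
      linarith
    have hAi : |κ A i| = R := by rw [hP, ← hp, ← habs hδ, hAR, abs_of_pos hR0]
    have hBi : |κ B i| = R := by rw [hP, ← hp, ← habs hε, hBR, abs_of_pos hR0]
    exact fun t ht r hr => ⟨hend t ht A r hAi hr, hend t ht B r hBi hr⟩

end PolynomialEnds

/-! ### Tameness of polynomial knots -/

section Completion

variable {n : ℕ} {κ : ℝ → Euc n}

theorem IsPolynomialKnot.tendsto_cocompact (hκ : IsPolynomialKnot κ) :
    Tendsto κ (cocompact ℝ) (cocompact (Euc n)) := by
  obtain ⟨P, hP⟩ := hκ.polynomial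
  obtain ⟨i, hi⟩ : ∃ i, 0 < (P i).degree := by
    by_contra! hcon
    refine zero_ne_one (hκ.injective (PiLp.ext fun j => ?_))
    rw [hP, hP, Polynomial.eq_C_of_degree_le_zero (hcon j)]
    simp
  rw [← Metric.cobounded_eq_cocompact (α := Euc n), ← tendsto_norm_atTop_iff_cobounded]
  refine tendsto_atTop_mono (fun t => PiLp.norm_apply_le (κ t) i) ?_
  simp_rw [hP]
  exact Polynomial.tendsto_norm_atTop _ hi tendsto_norm_cocompact_atTop

theorem completion_northPole : completion κ (northPole 1) = northPole n := by
  simp [completion]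

theorem completion_stereoInv (x : Euc 1) : completion κ (stereoInv x) = stereoInv (κ (x 0)) := by
  rw [completion, if_neg (stereoInv_ne_northPole x)]
  exact congrArg (fun t => stereoInv (κ t)) (stereoInv_castSucc_div x 0)

theorem range_completion : range (completion κ) = insert (northPole n) (stereoInv '' range κ) := by
  apply Subset.antisymm
  · rintro _ ⟨y, rfl⟩
    by_cases hy : y = northPole 1
    · left
      rw [hy, completion_northPole]
    · obtain ⟨x, rfl⟩ := exists_stereoInv_eq hy
      right
      exact ⟨_, mem_range_self _, (completion_stereoInv x).symm⟩
  · rintro _ (rfl | ⟨_, ⟨t, rfl⟩, rfl⟩)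
    · exact ⟨_, completion_northPole⟩
    · exact ⟨stereoInv (WithLp.toLp 2 fun _ => t), completion_stereoInv _⟩

/-- Continuity at the north pole is properness of `κ`; a continuous injection of a compact space
into a Hausdorff space is an embedding. -/
theorem IsPolynomialKnot.isTopologicalKnot_completion (hκ : IsPolynomialKnot κ) :
    IsTopologicalKnot (completion κ) := by
  have hcoord : Topology.IsClosedEmbedding fun x : Euc 1 => x 0 := by
    have h : Isometry fun x : Euc 1 => x 0 := Isometry.of_dist_eq fun x y => by
      simp [EuclideanSpace.dist_eq, Real.sqrt_sq_eq_abs, Real.dist_eq]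
    exact h.isClosedEmbedding
  have hcont : Continuous (completion κ ∘ stereoHomeo 1) := by
    rw [OnePoint.continuous_iff, coclosedCompact_eq_cocompact]
    have hfun : (fun x : Euc 1 => (completion κ ∘ stereoHomeo 1) (x : OnePoint (Euc 1))) =
        fun x : Euc 1 => stereoInv (κ (x 0)) := by
      funext x
      simp [completion_stereoInv]
    constructor
    · rw [hfun]
      simp only [Function.comp_apply, stereoHomeo_infty, completion_northPole]
      exact tendsto_stereoInv_cocompact.comp
        (hκ.tendsto_cocompact.comp hcoord.tendsto_cocompact)
    · rw [hfun]
      exact continuous_stereoInv.comp (hκ.contDiff.continuous.comp hcoord.continuous)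
  have hcont' : Continuous (completion κ) := (stereoHomeo 1).comp_continuous_iff'.1 hcont
  refine (hcont'.isClosedEmbedding fun y z h => ?_).isEmbedding
  by_cases hy : y = northPole 1 <;> by_cases hz : z = northPole 1
  · rw [hy, hz]
  · obtain ⟨x, rfl⟩ := exists_stereoInv_eq hz
    rw [hy, completion_northPole, completion_stereoInv] at h
    exact absurd h.symm (stereoInv_ne_northPole _)
  · obtain ⟨x, rfl⟩ := exists_stereoInv_eq hy
    rw [hz, completion_northPole, completion_stereoInv] at h
    exact absurd h (stereoInv_ne_northPole _)
  · obtain ⟨x, rfl⟩ := exists_stereoInv_eq hy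
    obtain ⟨x', rfl⟩ := exists_stereoInv_eq hz
    rw [completion_stereoInv, completion_stereoInv] at h
    rw [hcoord.injective (hκ.injective (stereoInv_injective h))]

end Completion

/-! ### Rays and distances under inversion. -/

section Inversion

variable {n : ℕ}

theorem norm_inversion_sub_inversion (ρ : Euc n ≃ₗᵢ[ℝ] Euc n) {x y : Euc n} (hx : x ≠ 0)
    (hy : y ≠ 0) : ‖(1 / ‖x‖) ^ 2 • ρ x - (1 / ‖y‖) ^ 2 • ρ y‖ = ‖x - y‖ / (‖x‖ * ‖y‖) := by
  rw [← map_smul, ← map_smul, ← map_sub, ρ.norm_map, ← dist_eq_norm,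
    dist_div_norm_sq_smul hx hy, dist_eq_norm]
  ring

/-- Inversion turns the factor `r ≥ 1` into `r⁻¹ ∈ (0, 1]`; the added point `0` is the image of `∞`.
-/
theorem inversion_image_ray (ρ : Euc n ≃ₗᵢ[ℝ] Euc n) (a : Euc n) :
    insert 0 ((fun x => (1 / ‖x‖) ^ 2 • ρ x) '' ((fun r : ℝ => r • a) '' Ici 1)) =
      segment ℝ 0 ((1 / ‖a‖) ^ 2 • ρ a) := by
  have hscale : ∀ r : ℝ, 0 < r → (1 / ‖r • a‖) ^ 2 • ρ (r • a) = r⁻¹ • (1 / ‖a‖) ^ 2 • ρ a := by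
    intro r hr
    rw [map_smul, norm_smul, Real.norm_of_nonneg hr.le, smul_smul, smul_smul]
    congr 1
    field_simp
  rw [segment_eq_image_lineMap]
  apply Subset.antisymm
  · rintro _ (rfl | ⟨_, ⟨r, hr, rfl⟩, rfl⟩)
    · exact ⟨0, by simp, by simp⟩
    · have hr0 : (0 : ℝ) < r := lt_of_lt_of_le one_pos hr
      refine ⟨r⁻¹, ⟨by positivity, inv_le_one_of_one_le₀ hr⟩, ?_⟩
      dsimp only
      rw [hscale r hr0]
      simp [AffineMap.lineMap_apply]
  · rintro _ ⟨s, hs, rfl⟩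
    rcases hs.1.eq_or_lt with rfl | hs0
    · left
      simp
    · right
      refine ⟨_, ⟨s⁻¹, one_le_inv_iff₀.2 ⟨hs0, hs.2⟩, rfl⟩, ?_⟩
      dsimp only
      rw [hscale _ (inv_pos.2 hs0), inv_inv]
      simp [AffineMap.lineMap_apply]

/-- A lower bound for the distance of two points gives one for the distance of their images under
the inversion, uniformly for points `y` outside a neighborhood of `0`. -/
theorem div_le_norm_inversion_sub (ρ : Euc n ≃ₗᵢ[ℝ] Euc n) {x y : Euc n} (hx : x ≠ 0) (hy : y ≠ 0)
    {c D D' : ℝ} (hxc : ‖x‖ ≤ c) (hD : 0 ≤ D) (hDD' : D ≤ D') (hxy : D ≤ ‖x - y‖) :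
    D / (c * (D' + c)) ≤ ‖(1 / ‖x‖) ^ 2 • ρ x - (1 / ‖y‖) ^ 2 • ρ y‖ := by
  have hx0 : 0 < ‖x‖ := norm_pos_iff.2 hx
  have hy0 : 0 < ‖y‖ := norm_pos_iff.2 hy
  have hc : 0 < c := hx0.trans_le hxc
  rw [norm_inversion_sub_inversion ρ hx hy]
  have h1 : ‖y‖ ≤ ‖x - y‖ + c := by
    have := norm_sub_le x (x - y)
    rw [sub_sub_cancel] at this
    linarith
  calc D / (c * (D' + c)) ≤ D / (c * (D + c)) := by gcongr
    -- The function `D ↦ D / (D + c)` is increasing, which makes the bound independent of the size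
    -- of `y`.
    _ ≤ ‖x - y‖ / (c * (‖x - y‖ + c)) := by
      rw [div_le_div_iff₀ (by positivity) (by positivity)]
      nlinarith [mul_le_mul_of_nonneg_left hxy (mul_pos hc hc).le]
    _ ≤ ‖x - y‖ / (‖x‖ * ‖y‖) := by gcongr

end Inversion

/-! ### Closing a polygonal arc through one additional vertex. -/

section ClosedPolygon

variable {E : Type*} [NormedAddCommGroup E] [NormedSpace ℝ E]

theorem polygon_cons_boundary (o : E) (w : ℕ → E) (N : ℕ) :
    (⟨Fin.cons o fun k : Fin (N + 1) => w k⟩ : Polygon E (N + 2)).boundary ℝ =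
      (segment ℝ o (w 0) ∪ segment ℝ o (w N)) ∪ ⋃ k < N, segment ℝ (w k) (w (k + 1)) := by
  have hfirst : finRotate (N + 2) 0 = Fin.succ 0 := by
    rw [finRotate_apply]
    simp
  have hmid : ∀ (k : ℕ) (hk : k < N), finRotate (N + 2) (Fin.succ ⟨k, by omega⟩) =
      Fin.succ ⟨k + 1, by omega⟩ := by
    intro k hk
    rw [finRotate_of_lt (by simpa using by omega)]
    rfl
  have hlast : finRotate (N + 2) (Fin.succ (Fin.last N)) = 0 := finRotate_last
  unfold Polygon.boundary Polygon.edgeSet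
  simp only [affineSegment_eq_segment]
  apply Subset.antisymm
  · refine iUnion_subset fun k => ?_
    induction k using Fin.cases with
    | zero =>
      rw [hfirst]
      exact subset_union_of_subset_left subset_union_left _
    | succ k =>
      rcases k.le_last.eq_or_lt with rfl | hk
      · rw [hlast, segment_symm]
        refine subset_union_of_subset_left (subset_union_of_subset_right ?_ _) _
        simp
      · have hk' : (k : ℕ) < N := hk
        have := hmid k hk'
        rw [Fin.eta] at this
        rw [this]
        refine subset_union_of_subset_right ?_ _
        exact subset_biUnion_of_mem (u := fun k => segment ℝ (w k) (w (k + 1))) hk'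
  · refine union_subset (union_subset ?_ ?_) (iUnion₂_subset fun k hk => ?_)
    · refine subset_iUnion_of_subset 0 ?_
      rw [hfirst]
      simp
    · refine subset_iUnion_of_subset (Fin.succ (Fin.last N)) ?_
      rw [hlast, segment_symm]
      simp
    · refine subset_iUnion_of_subset (Fin.succ ⟨k, by omega⟩) ?_
      rw [hmid k hk]
      exact Subset.rfl

end ClosedPolygon

/-- The closure of a polynomial knot in the sphere is taken to a closed polygon by an
orientation-preserving homeomorphism. -/
theorem IsPolynomialKnot.exists_homeomorph_image_eq_polygon {n : ℕ} (hn : 2 ≤ n) {κ : ℝ → Euc n}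
    (hκ : IsPolynomialKnot κ) :
    ∃ (g : Sph n ≃ₜ Sph n) (k : ℕ) (P : Polygon (Euc n) k), IsOrientationPreserving g ∧
      g '' range (completion κ) = stereoInv '' P.boundary ℝ := by
  obtain ⟨H, q, A, B, m, ⟨g₁, hg₁, hg₁n, hg₁x⟩, hAB, hm, hq, hH, hdist⟩ := hκ.exists_radial_ends hn
  obtain ⟨g₂, ρ, hg₂, hg₂n, hg₂x⟩ := exists_halfTurn (⟨0, by omega⟩ : Fin n)
  have hA : A ∈ Icc A B := ⟨le_rfl, hAB⟩
  have hB : B ∈ Icc A B := ⟨hAB, le_rfl⟩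
  let I : Euc n → Euc n := fun x => (1 / ‖x‖) ^ 2 • ρ x
  let Γ : ℝ → Euc n := fun t => I (κ t - q)
  -- The inverted ends, joined at the image `0` of the north pole; they are already polygonal and
  -- must stay fixed.
  let S : Set (Euc n) := segment ℝ 0 (Γ A) ∪ segment ℝ 0 (Γ B)
  have hκ1 := hκ.contDiff
  -- regularity of the arc `Γ`
  let U : Set ℝ := {t | κ t - q ≠ 0}
  have hU : IsOpen U := isOpen_ne_fun (hκ1.continuous.sub continuous_const) continuous_const
  have hΓ1 : ContDiffOn ℝ 1 Γ U := by
    intro t ht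
    have h1 : ContDiffAt ℝ 1 (fun t => κ t - q) t := hκ1.contDiffAt.sub contDiffAt_const
    have h2 : ContDiffAt ℝ 1 (fun t => (1 / ‖κ t - q‖) ^ 2) t :=
      ((contDiffAt_const (c := (1 : ℝ))).div (h1.norm ℝ ht) (norm_ne_zero_iff.2 ht)).pow 2
    have h3 : ContDiffAt ℝ 1 (fun t => ρ (κ t - q)) t :=
      ρ.contDiff.contDiffAt.comp t h1
    exact (h2.smul h3).contDiffWithinAt
  have hAU : Icc A B ⊆ U := hq
  have hΓd : ∀ t ∈ Icc A B, HasDerivAt Γ (deriv Γ t) t := fun t ht =>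
    ((hΓ1.differentiableOn one_ne_zero).differentiableAt (hU.mem_nhds (hAU ht))).hasDerivAt
  have hΓc : ContinuousOn (deriv Γ) (Icc A B) :=
    (hΓ1.continuousOn_deriv_of_isOpen hU le_rfl).mono hAU
  -- distance estimates
  obtain ⟨c, hc⟩ := isCompact_Icc.exists_bound_of_continuousOn (s := Icc A B)
    (f := fun t => κ t - q) (by
      have := hκ1.continuous
      fun_prop)
  have hc0 : 0 < c := (norm_pos_iff.2 (hq A hA)).trans_le (hc A hA)
  obtain ⟨m₁, hm₁, hlow⟩ := exists_lower_lipschitz_bound (a := A) (b := B)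
    (fun t _ => (hκ1.differentiable one_ne_zero t).hasDerivAt)
    ((hκ1.continuous_deriv le_rfl).continuousOn) hκ.injective.injOn
    (fun t _ => hκ.deriv_ne_zero t)
  have hBA : 0 ≤ B - A := sub_nonneg.2 hAB
  -- The first bound is for two points of the arc, both of norm at most `c` before inversion, the
  -- second for a point of the arc and one of `S`.
  set m₂ : ℝ := min (m₁ / c ^ 2) (m / (c * (m * (B - A) + c))) with hm₂
  have hm₂0 : 0 < m₂ := lt_min (by positivity) (by positivity)
  have hlowΓ : ∀ s ∈ Icc A B, ∀ t ∈ Icc A B, m₂ * |s - t| ≤ ‖Γ s - Γ t‖ := by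
    intro s hs t ht
    have h1 : ‖Γ s - Γ t‖ = ‖κ s - κ t‖ / (‖κ s - q‖ * ‖κ t - q‖) := by
      simp only [Γ, I]
      rw [norm_inversion_sub_inversion ρ (hq s hs) (hq t ht), sub_sub_sub_cancel_right]
    rw [h1]
    have hs0 := norm_pos_iff.2 (hq s hs)
    have ht0 := norm_pos_iff.2 (hq t ht)
    calc m₂ * |s - t| ≤ m₁ / c ^ 2 * |s - t| := by
          gcongr
          exact min_le_left _ _
      _ = (m₁ * |s - t|) / (c * c) := by ring
      _ ≤ ‖κ s - κ t‖ / (‖κ s - q‖ * ‖κ t - q‖) := by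
          gcongr
          · exact hlow s hs t ht
          · exact hc s hs
          · exact hc t ht
  have hSeg : ∀ t : ℝ, segment ℝ 0 (Γ t) =
      insert 0 (I '' ((fun r : ℝ => r • (κ t - q)) '' Ici 1)) := fun t =>
    (inversion_image_ray ρ (κ t - q)).symm
  have hS : ∀ t ∈ Icc A B, ∀ x ∈ S, m₂ * min (t - A) (B - t) ≤ ‖Γ t - x‖ := by
    intro t ht x hx
    set D : ℝ := m * min (t - A) (B - t) with hD
    have hmin : 0 ≤ min (t - A) (B - t) := le_min (sub_nonneg.2 ht.1) (sub_nonneg.2 ht.2)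
    have hD0 : 0 ≤ D := mul_nonneg hm.le hmin
    have hD' : D ≤ m * (B - A) := by
      rw [hD]
      gcongr
      exact (min_le_left _ _).trans (by linarith [ht.2])
    have hm₂D : m₂ * min (t - A) (B - t) ≤ D / (c * (m * (B - A) + c)) := by
      calc m₂ * min (t - A) (B - t)
          ≤ m / (c * (m * (B - A) + c)) * min (t - A) (B - t) := by
            gcongr
            exact min_le_right _ _
        _ = D / (c * (m * (B - A) + c)) := by rw [hD]; ring
    refine hm₂D.trans ?_
    have hzero : D / (c * (m * (B - A) + c)) ≤ ‖Γ t - 0‖ := by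
      have h1 : ‖Γ t‖ = 1 / ‖κ t - q‖ := by
        have h0 := norm_pos_iff.2 (hq t ht)
        simp only [Γ, I]
        rw [norm_smul, ρ.norm_map, Real.norm_of_nonneg (by positivity)]
        field_simp
      rw [sub_zero, h1, div_le_div_iff₀ (by positivity) (norm_pos_iff.2 (hq t ht))]
      have h2 := mul_le_mul hD' (hc t ht) (norm_nonneg _) (by positivity)
      nlinarith
    have hray : ∀ u ∈ Icc A B, (∀ r ≥ (1 : ℝ), D ≤ ‖κ t - q - r • (κ u - q)‖) →
        x ∈ segment ℝ 0 (Γ u) → D / (c * (m * (B - A) + c)) ≤ ‖Γ t - x‖ := by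
      intro u hu hr hxu
      rw [hSeg] at hxu
      rcases hxu with rfl | ⟨_, ⟨r, hr1, rfl⟩, rfl⟩
      · exact hzero
      · exact div_le_norm_inversion_sub ρ (hq t ht)
          (smul_ne_zero (lt_of_lt_of_le one_pos hr1).ne' (hq u hu)) (hc t ht) hD0 hD' (hr r hr1)
    rcases hx with hx | hx
    · exact hray A hA (fun r hr => (hdist t ht r hr).1) hx
    · exact hray B hB (fun r hr => (hdist t ht r hr).2) hx
  obtain ⟨N, e, hN, ⟨g₃, hg₃, hg₃n, hg₃x⟩, heS, heΓ⟩ :=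
    exists_extendsOriented_inscribed hAB hΓd hΓc hm₂0 hlowΓ hS
  let w : ℕ → Euc n := fun k => Γ (partitionPoint A B N k)
  let P : Polygon (Euc n) (N + 2) := ⟨Fin.cons 0 fun k : Fin (N + 1) => w k⟩
  have hP : P.boundary ℝ = S ∪ ⋃ k < N, segment ℝ (w k) (w (k + 1)) := by
    have h0 : w 0 = Γ A := by simp only [w, partitionPoint_zero]
    have h1 : w N = Γ B := by simp only [w, partitionPoint_self A B hN]
    rw [show P.boundary ℝ = _ from polygon_cons_boundary 0 w N, h0, h1]
  have heP : e '' P.boundary ℝ = S ∪ Γ '' Icc A B := by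
    rw [hP, image_union, heΓ]
    congr 1
    apply Subset.antisymm
    · rintro _ ⟨x, hx, rfl⟩
      rwa [heS x hx]
    · exact fun x hx => ⟨x, hx, heS x hx⟩
  have himg₁ : g₁ '' range (completion κ) = insert (northPole n) (stereoInv '' (H '' range κ)) := by
    rw [range_completion, image_insert_eq, hg₁n, image_image, image_image]
    simp only [hg₁x]
  have hne : ∀ x ∈ H '' range κ, x ≠ 0 := by
    rw [hH]
    rintro _ (⟨t, ht, rfl⟩ | ⟨r, hr, rfl⟩ | ⟨r, hr, rfl⟩)
    · exact hq t ht
    · exact smul_ne_zero (lt_of_lt_of_le one_pos hr).ne' (hq A hA)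
    · exact smul_ne_zero (lt_of_lt_of_le one_pos hr).ne' (hq B hB)
  have himg₂ : g₂ '' (g₁ '' range (completion κ)) = stereoInv '' (S ∪ Γ '' Icc A B) := by
    have h1 : S ∪ Γ '' Icc A B = insert 0 (I '' (H '' range κ)) := by
      rw [hH, image_union, image_union, image_image]
      simp only [S, hSeg]
      ext x
      simp only [mem_union, mem_insert_iff, Γ]
      tauto
    rw [himg₁, image_insert_eq, hg₂n, h1, image_insert_eq]
    congr 1
    rw [image_image, image_image (g := stereoInv)]
    exact image_congr fun x hx => hg₂x x (hne x hx)
  refine ⟨(g₁.trans g₂).trans g₃.symm, N + 2, P, (hg₁.trans hg₂).trans hg₃.symm, ?_⟩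
  have himg₃ : g₃ '' (stereoInv '' P.boundary ℝ) = stereoInv '' (S ∪ Γ '' Icc A B) := by
    rw [← heP, image_image, image_image]
    simp only [hg₃x]
  have hcomp : ((g₁.trans g₂).trans g₃.symm) '' range (completion κ) =
      g₃.symm '' (g₂ '' (g₁ '' range (completion κ))) := by
    rw [image_image, image_image]
    rfl
  rw [hcomp, himg₂, ← himg₃, image_image]
  simp

theorem mainTheorem5 (n : ℕ) (hn : 2 ≤ n) (κ : ℝ → Euc n) (hκ : IsPolynomialKnot κ) :
    IsTame (completion κ) := by
  obtain ⟨g, k, P, hg, himg⟩ := hκ.exists_homeomorph_image_eq_polygon hn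
  have hknot := hκ.isTopologicalKnot_completion
  -- The polygon is traced with the parametrization inherited from the completion, so the identity
  -- serves on the circle.
  refine ⟨hknot, g ∘ completion κ, ⟨g.isEmbedding.comp hknot, k, P, ?_⟩,
    Homeomorph.refl _, g.symm, .refl 1, hg.symm, ?_⟩
  · rw [range_comp, himg]
  · funext y
    simp
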